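/- Let $H$ be a complex Hilbert space that is not one-dimensional, let $\mathbb B(H)$ be the bounded linear operators on $H$ with the operator norm $\|\cdot\|$ and the operator order, $\mathbb B(H)^+$ the positive operators, and $\mathbb P$ the positive invertible operators. SOT denotes the strong operator topology; $A_k\searrow A$ (resp. $A_k\nearrow A$) means that $A_k$ is decreasing (resp. increasing) and $A_k\to A$ in SOT. An *operator mean* is a map $\sigma:\mathbb B(H)^+\times\mathbb B(H)^+\to\mathbb B(H)^+$ such that: (i) $A\le C$, $B\le D$ imply $A\,\sigma\,B\le C\,\sigma\,D$; (ii) $C(A\,\sigma\,B)C\le (CAC)\,\sigma\,(CBC)$ for $C\in\mathbb B(H)^+$; (iii) $A_k\searrow A$, $B_k\searrow B$ imply $A_k\,\sigma\,B_k\searrow A\,\sigma\,B$; (iv) $I\,\sigma\,I=I$. An *$n$-variable operator mean* is a map $\mathfrak M:\mathbb P^n\to\mathbb P$ such that: (I) $A_j\le B_j$ for all $j$ implies $\mathfrak M(A_1,\dots,A_n)\le\mathfrak M(B_1,\dots,B_n)$; (II) $S^*\mathfrak M(A_1,\dots,A_n)S=\mathfrak M(S^*A_1S,\dots,S^*A_nS)$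 for every invertible $S\in\mathbb B(H)$; (III) if $A_{jk},A_j\in\mathbb P$ and either $A_{jk}\nearrow A_j$ for all $j$ or $A_{jk}\searrow A_j$ for all $j$ as $k\to\infty$, then $\mathfrak M(A_{1k},\dots,A_{nk})\to\mathfrak M(A_1,\dots,A_n)$ in SOT; (IV) $\mathfrak M(I,\dots,I)=I$. Let $\sigma$ be an operator mean other than the left trivial mean $A\,\ell\,B=A$, and let $\mathfrak M$ be an $n$-variable operator mean such that, for some probability vector $\omega=(\omega_1,\dots,\omega_n)$ ($\omega_j\ge0$, $\sum_j\omega_j=1$), $$\Bigl(\sum_{j=1}^n\omega_jB_j^{-1}\Bigr)^{-1}\le\mathfrak M(B_1,\dots,B_n)\le\sum_{j=1}^n\omega_jB_j\qquad\text{for all }B_1,\dots,B_n\in\mathbb P.$$ Let $0<m<M$ be scalars, $h=M/m$, and let $A_1,\dots,A_n\in\mathbb P$ satisfy $mI\le A_j\le MI$ for all $j$. For $x>0$, $x\ne1$ and $r\ne0,1$ put $$K(x,r)=\frac{x^r-x}{(r-1)(x-1)}\left(\frac{r-1}{r}\,\frac{x^r-1}{x^r-x}\right)^r,\qquad S(x)=\frac{(x-1)x^{1/(x-1)}}{e\log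 x},\qquad S(1)=1 .$$ Then for all $B_1,\dots,B_n\in\mathbb P$ the equation $X=\mathfrak M(X\,\sigma\,B_1,\dots,X\,\sigma\,B_n)$ has exactly one solution $X\in\mathbb P$; this solution is denoted by $\mathfrak M_\sigma(B_1,\dots,B_n)$ (the deformed mean). Moreover, for all $0<q<p$, $$K(h^p,-q/p)^{-1/q}\,\|\mathfrak M_\sigma(A_1^p,\dots,A_n^p)\|^{1/p}\le\|\mathfrak M_\sigma(A_1^q,\dots,A_n^q)\|^{1/q}\le K(h^p,-q/p)^{1/q}\,\|\mathfrak M_\sigma(A_1^p,\dots,A_n^p)\|^{1/p},$$ and, for all $p>0$, $$S(h^p)^{-1/p}\,\|\mathfrak M_\sigma(A_1^p,\dots,A_n^p)\|^{1/p}\le\Bigl\|\exp\Bigl(\sum_{j=1}^n\omega_j\log A_j\Bigr)\Bigr\|\le S(h^p)^{1/p}\,\|\mathfrak M_\sigma(A_1^p,\dots,A_n^p)\|^{1/p}.$$ -/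

import Mathlib

open Filter Topology

section OperatorMeans

variable {H : Type*} [NormedAddCommGroup H] [InnerProductSpace ℂ H] [CompleteSpace H]

/-- Convergence of a sequence of bounded operators in the strong operator topology. -/
def TendstoSOT (A : ℕ → (H →L[ℂ] H)) (L : H →L[ℂ] H) : Prop :=
  ∀ x : H, Tendsto (fun k => A k x) atTop (𝓝 (L x))

/-- `A_k ↘ L`: the sequence is decreasing in the operator order and tends to `L` in SOT. -/
def DecreasesTo (A : ℕ → (H →L[ℂ] H)) (L : H →L[ℂ] H) : Prop :=
  Antitone A ∧ TendstoSOT A L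

/-- `A_k ↗ L`: the sequence is increasing in the operator order and tends to `L` in SOT. -/
def IncreasesTo (A : ℕ → (H →L[ℂ] H)) (L : H →L[ℂ] H) : Prop :=
  Monotone A ∧ TendstoSOT A L

/-- `σ` is a two-variable operator mean in the sense of Kubo and Ando. Only the restriction of `σ`
to pairs of positive operators matters. -/
structure IsOperatorMean (σ : (H →L[ℂ] H) → (H →L[ℂ] H) → (H →L[ℂ] H)) : Prop where
  nonneg : ∀ A B, 0 ≤ A → 0 ≤ B → 0 ≤ σ A B
  mono : ∀ A B C D, 0 ≤ A → 0 ≤ B → A ≤ C → B ≤ D → σ A B ≤ σ C D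
  transformer : ∀ A B C, 0 ≤ A → 0 ≤ B → 0 ≤ C →
    C * σ A B * C ≤ σ (C * A * C) (C * B * C)
  downward_continuous : ∀ (A B : ℕ → (H →L[ℂ] H)) (A' B' : H →L[ℂ] H),
    (∀ k, 0 ≤ A k) → (∀ k, 0 ≤ B k) → 0 ≤ A' → 0 ≤ B' →
    DecreasesTo A A' → DecreasesTo B B' → DecreasesTo (fun k => σ (A k) (B k)) (σ A' B')
  normalized : σ 1 1 = 1

/-- `σ` is the left trivial mean, `A σ B = A` for all positive operators `A`, `B`. -/
def IsLeftTrivial (σ : (H →L[ℂ] H) → (H →L[ℂ] H) → (H →L[ℂ] H)) : Prop :=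
  ∀ A B, 0 ≤ A → 0 ≤ B → σ A B = A

/-- `𝔐` is an `n`-variable operator mean: a map of `n`-tuples of positive invertible operators to
positive invertible operators that is monotone, invariant under congruence, continuous along
monotone sequences, and normalized. Only the restriction of `𝔐` to tuples of positive invertible
operators (`IsStrictlyPositive`) matters. -/
structure IsMultiOperatorMean {n : ℕ} (𝔐 : (Fin n → (H →L[ℂ] H)) → (H →L[ℂ] H)) : Prop where
  strictlyPositive : ∀ A, (∀ j, IsStrictlyPositive (A j)) → IsStrictlyPositive (𝔐 A)
  mono : ∀ A B, (∀ j, IsStrictlyPositive (A j)) → (∀ j, IsStrictlyPositive (B j)) →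
    (∀ j, A j ≤ B j) → 𝔐 A ≤ 𝔐 B
  congruence : ∀ (A) (S : H →L[ℂ] H), (∀ j, IsStrictlyPositive (A j)) → IsUnit S →
    star S * 𝔐 A * S = 𝔐 (fun j => star S * A j * S)
  monotone_continuous : ∀ (A : ℕ → Fin n → (H →L[ℂ] H)) (L : Fin n → (H →L[ℂ] H)),
    (∀ k j, IsStrictlyPositive (A k j)) → (∀ j, IsStrictlyPositive (L j)) →
    ((∀ j, IncreasesTo (fun k => A k j) (L j)) ∨ (∀ j, DecreasesTo (fun k => A k j) (L j))) →
    TendstoSOT (fun k => 𝔐 (A k)) (𝔐 L)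
  normalized : 𝔐 (fun _ => 1) = 1

/-- The weighted arithmetic mean `∑ ω_j A_j`. -/
noncomputable def arithmeticMean {n : ℕ} (ω : Fin n → ℝ) (A : Fin n → (H →L[ℂ] H)) :
    H →L[ℂ] H :=
  ∑ j, ω j • A j

/-- The weighted harmonic mean `(∑ ω_j A_j⁻¹)⁻¹`. -/
noncomputable def harmonicMean {n : ℕ} (ω : Fin n → ℝ) (A : Fin n → (H →L[ℂ] H)) :
    H →L[ℂ] H :=
  Ring.inverse (∑ j, ω j • Ring.inverse (A j))

/-- `X` is a positive invertible solution of `X = 𝔐(X σ A_1, …, X σ A_n)`. -/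
def IsDeformedMeanSolution {n : ℕ} (𝔐 : (Fin n → (H →L[ℂ] H)) → (H →L[ℂ] H))
    (σ : (H →L[ℂ] H) → (H →L[ℂ] H) → (H →L[ℂ] H)) (A : Fin n → (H →L[ℂ] H))
    (X : H →L[ℂ] H) : Prop :=
  IsStrictlyPositive X ∧ X = 𝔐 (fun j => σ X (A j))

open Classical in
/-- The deformed mean `𝔐_σ(A_1, …, A_n)`: the positive invertible solution of
`X = 𝔐(X σ A_1, …, X σ A_n)` (and `0` if there is none). -/
noncomputable def deformedMean {n : ℕ} (𝔐 : (Fin n → (H →L[ℂ] H)) → (H →L[ℂ] H))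
    (σ : (H →L[ℂ] H) → (H →L[ℂ] H) → (H →L[ℂ] H)) (A : Fin n → (H →L[ℂ] H)) :
    H →L[ℂ] H :=
  if h : ∃ X, IsDeformedMeanSolution 𝔐 σ A X then h.choose else 0

end OperatorMeans

/-- The generalized Kantorovich constant `K(h, p)`, for `h > 0`, `h ≠ 1` and `p ≠ 0, 1`. -/
noncomputable def kantorovichConst (h p : ℝ) : ℝ :=
  (h ^ p - h) / ((p - 1) * (h - 1)) * ((p - 1) / p * ((h ^ p - 1) / (h ^ p - h))) ^ p

/-- The Specht ratio `S(h)`, for `h > 0`. -/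
noncomputable def spechtRatio (h : ℝ) : ℝ :=
  if h = 1 then 1 else (h - 1) * h ^ (1 / (h - 1)) / (Real.exp 1 * Real.log h)

/-! The heart of the matter is the sandwich `harmonicMean ω B ≤ X ≤ arithmeticMean ω B` for the
solution `X`. Once it is known, the norm inequalities concern only weighted sums of powers of the `A
j`; neither `σ` nor `𝔐` is needed further.

The mean `σ` is controlled by its representing function `f`, where `σ 1 (t • 1) = f t • 1`. Since
`dim H ≥ 2`, there are two lines at any prescribed angle, and comparing operators with two spectral
values along them shows that `f` and its adjoint `s ↦ 1 / f (1 / s)` are both concave. If `σ` is not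
left trivial, these two concavities force `f` to be strictly increasing. The tangent line `f t ≤ 1 +
α (t - 1)` with `α > 0` gives `σ X B ≤ (1 - α) X + α B`, and the adjoint gives the same for
inverses. The identity `σ 1 C = f(C)` is never proved: scalar inequalities pass to operators by
compressing to spectral subspaces on which `C` is nearly constant (`nonneg_of_forall_compression`).

The map `Φ X = 𝔐 (X σ B_j)` is monotone and preserves an order interval `[a, b]`, so its iterates
from `b` decrease to a fixed point. Strict increase of `f` gives `σ (l X) B ≤ μ σ X B` with `μ < l`
for `l > 1`, so the least `l ≥ 1` with `X ≤ l Y` is 1 for any two solutions; this is uniqueness.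
Inserting the affine bound in `X = 𝔐 (X σ B_j) ≤ ∑ ω_j (X σ B_j)` and cancelling `(1 - α) X` gives
the sandwich.

The constants come from the Mond–Pečarić method: the chord of a convex function over an interval
lies below a multiple of that function, and `K` or `S` is the multiple at which they touch. Applied
to `x ^ (-q/p)` and to `exp`, this reverses Jensen's inequality
(`sum_rpow_neg_le_kantorovichConst_smul`, `sum_exp_le_spechtRatio_smul`). One side of each norm
inequality then follows directly, the other after inversion. -/

section ScalarBounds

/-! ### Scalar inequalities behind the Kantorovich and Specht constants. -/

/-- The chord of `x ↦ x ^ (-r)` over `[1, h]` lies below `K(h, -r) x ^ (-r)`. -/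
theorem chord_le_kantorovichConst_mul_rpow {h r u : ℝ} (hh : 1 < h) (hr : 0 < r) (hu : 0 < u) :
    1 + (h ^ (-r) - 1) / (h - 1) * (u - 1) ≤ kantorovichConst h (-r) * u ^ (-r) := by
  have h0 : 0 < h := by linarith
  have hlt : h ^ (-r) < 1 := Real.rpow_lt_one_of_one_lt_of_neg hh (by linarith)
  set k := h ^ (-r) with hk
  have ha : 0 < h - k := by linarith
  have hb : 0 < 1 - k := by linarith
  have hbase : (-r - 1) / (-r) * ((k - 1) / (k - h)) = (1 + r) * (1 - k) / (r * (h - k)) := by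
    rw [div_mul_div_comm, div_eq_div_iff (by nlinarith) (by positivity)]
    ring
  have hK : kantorovichConst h (-r) * u ^ (-r) = (h - k) / ((1 + r) * (h - 1)) *
      ((1 + r) * (1 - k) / (r * (h - k)) * u) ^ (-r) := by
    rw [kantorovichConst, ← hk, hbase, Real.mul_rpow (by positivity) hu.le, ← mul_assoc]
    congr 2
    rw [div_eq_div_iff (by nlinarith) (by nlinarith)]
    ring
  -- In this variable the contact point is at `v = 1`: up to one common factor, the chord is the
  -- tangent line there of `v ^ (-r)`.
  set v := (1 + r) * (1 - k) / (r * (h - k)) * u with hv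
  have hv0 : 0 < v := by positivity
  have hbern : 1 + r - r * v ≤ v ^ (-r) := by
    rw [Real.rpow_def_of_pos hv0]
    nlinarith [Real.add_one_le_exp (Real.log v * -r), Real.log_le_sub_one_of_pos hv0]
  have hchord : 1 + (k - 1) / (h - 1) * (u - 1) =
      (h - k) / ((1 + r) * (h - 1)) * (1 + r - r * v) := by
    rw [hv]
    have : h - 1 ≠ 0 := by linarith
    field_simp
    ring
  rw [hK, hchord]
  have : 0 < h - 1 := by linarith
  gcongr

theorem one_le_kantorovichConst {h r : ℝ} (hh : 1 < h) (hr : 0 < r) :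
    1 ≤ kantorovichConst h (-r) := by
  simpa using chord_le_kantorovichConst_mul_rpow hh hr one_pos

/-- The chord of `exp` over `[0, log k]` lies below `S(k) exp`. -/
theorem chord_le_spechtRatio_mul_exp {k : ℝ} (hk : 1 < k) (y : ℝ) :
    1 + (k - 1) / Real.log k * y ≤ spechtRatio k * Real.exp y := by
  have hl : 0 < Real.log k := Real.log_pos hk
  have hk0 : 0 < k := by linarith
  have hk1 : 0 < k - 1 := by linarith
  have hS : spechtRatio k * Real.exp y =
      (k - 1) / Real.log k * Real.exp (y + Real.log k / (k - 1) - 1) := by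
    rw [spechtRatio, if_neg hk.ne', Real.rpow_def_of_pos hk0, mul_one_div, Real.exp_sub,
      Real.exp_add]
    field_simp
  -- `S(k) exp y` is a multiple of the exponential of this shifted argument; the chord is its
  -- tangent line where that argument vanishes.
  have := Real.add_one_le_exp (y + Real.log k / (k - 1) - 1)
  rw [hS]
  calc 1 + (k - 1) / Real.log k * y
      = (k - 1) / Real.log k * (y + Real.log k / (k - 1) - 1 + 1) := by field_simp; ring
    _ ≤ _ := by gcongr

theorem one_le_spechtRatio {k : ℝ} (hk : 1 < k) : 1 ≤ spechtRatio k := by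
  simpa using chord_le_spechtRatio_mul_exp hk 0

theorem ConvexOn.le_chord {f : ℝ → ℝ} {a b x : ℝ} (hf : ConvexOn ℝ (Set.Icc a b) f)
    (hab : a < b) (hx : x ∈ Set.Icc a b) :
    f x ≤ f a + (f b - f a) / (b - a) * (x - a) := by
  have hba : 0 < b - a := sub_pos.2 hab
  have h := hf.2 (Set.left_mem_Icc.2 hab.le) (Set.right_mem_Icc.2 hab.le)
    (div_nonneg (sub_nonneg.2 hx.2) hba.le) (div_nonneg (sub_nonneg.2 hx.1) hba.le)
    (by rw [← add_div, sub_add_sub_cancel, div_self hba.ne'])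
  simp only [smul_eq_mul] at h
  have hx' : (b - x) / (b - a) * a + (x - a) / (b - a) * b = x := by field_simp; ring
  rw [hx'] at h
  refine h.trans_eq ?_
  field_simp
  ring

theorem convexOn_rpow_neg {r : ℝ} (hr : 0 ≤ r) :
    ConvexOn ℝ (Set.Ioi 0) fun x : ℝ => x ^ (-r) := by
  have h : ConvexOn ℝ (Set.Ioi 0) fun x : ℝ => Real.exp (r * -Real.log x) := by
    have hl : ConvexOn ℝ (Set.Ioi 0) fun x : ℝ => r * -Real.log x :=
      strictConcaveOn_log_Ioi.concaveOn.neg.smul hr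
    refine ⟨hl.1, fun x hx y hy a b ha hb hab => ?_⟩
    exact (Real.exp_monotone (hl.2 hx hy ha hb hab)).trans
      (convexOn_exp.2 trivial trivial ha hb hab)
  refine h.congr fun x hx => ?_
  simp only [Real.rpow_def_of_pos (Set.mem_Ioi.1 hx)]
  congr 1
  ring

end ScalarBounds

/-! ### The Mond–Pečarić method for operators. -/

section MondPecaric

variable {H : Type*} [NormedAddCommGroup H] [InnerProductSpace ℂ H] [CompleteSpace H]

theorem smul_one_le_iff_le_spectrum {T : H →L[ℂ] H} (hT : IsSelfAdjoint T) {a : ℝ} :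
    a • (1 : H →L[ℂ] H) ≤ T ↔ ∀ x ∈ spectrum ℝ T, a ≤ x := by
  rw [← algebraMap_le_iff_le_spectrum hT, Algebra.algebraMap_eq_smul_one]

theorem le_smul_one_iff_spectrum_le {T : H →L[ℂ] H} (hT : IsSelfAdjoint T) {a : ℝ} :
    T ≤ a • (1 : H →L[ℂ] H) ↔ ∀ x ∈ spectrum ℝ T, x ≤ a := by
  rw [← le_algebraMap_iff_spectrum_le hT, Algebra.algebraMap_eq_smul_one]

theorem cfc_affine {T : H →L[ℂ] H} (hT : IsSelfAdjoint T) (c d : ℝ) :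
    cfc (fun x : ℝ => d + c * x) T = d • (1 : H →L[ℂ] H) + c • T := by
  rw [cfc_const_add d (fun x => c * x) T, cfc_const_mul c (fun x => x) T, cfc_id' ℝ T,
    Algebra.algebraMap_eq_smul_one]

/-- The weighted sum of selfadjoint operators between `a` and `b` lies between `a` and `b`. -/
theorem arithmeticMean_mem_bounds {n : ℕ} {ω : Fin n → ℝ} (hω : ∀ j, 0 ≤ ω j) (hω1 : ∑ j, ω j = 1)
    {L : Fin n → (H →L[ℂ] H)} {a b : ℝ} (ha : ∀ j, a • (1 : H →L[ℂ] H) ≤ L j)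
    (hb : ∀ j, L j ≤ b • (1 : H →L[ℂ] H)) :
    a • (1 : H →L[ℂ] H) ≤ ∑ j, ω j • L j ∧ ∑ j, ω j • L j ≤ b • (1 : H →L[ℂ] H) := by
  have key : ∀ c : ℝ, c • (1 : H →L[ℂ] H) = ∑ j, ω j • c • (1 : H →L[ℂ] H) := fun c => by
    rw [← Finset.sum_smul, hω1, one_smul]
  constructor
  · rw [key a]
    exact Finset.sum_le_sum fun j _ => smul_le_smul_of_nonneg_left (ha j) (hω j)
  · rw [key b]
    exact Finset.sum_le_sum fun j _ => smul_le_smul_of_nonneg_left (hb j) (hω j)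

/-- The Mond–Pečarić method: comparison of a weighted sum of `f (L j)` with `g` of the weighted
sum, through an affine function that separates `f` and `g` on `[a, b]`. -/
theorem sum_cfc_le_cfc_sum {n : ℕ} {ω : Fin n → ℝ} (hω : ∀ j, 0 ≤ ω j) (hω1 : ∑ j, ω j = 1)
    {L : Fin n → (H →L[ℂ] H)} (hL : ∀ j, IsSelfAdjoint (L j)) {a b : ℝ}
    (ha : ∀ j, a • (1 : H →L[ℂ] H) ≤ L j) (hb : ∀ j, L j ≤ b • (1 : H →L[ℂ] H))
    {f g : ℝ → ℝ} (hf : ContinuousOn f (Set.Icc a b)) (hg : ContinuousOn g (Set.Icc a b))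
    {c d : ℝ} (hfc : ∀ x ∈ Set.Icc a b, f x ≤ d + c * x)
    (hgc : ∀ x ∈ Set.Icc a b, d + c * x ≤ g x) :
    ∑ j, ω j • cfc f (L j) ≤ cfc g (∑ j, ω j • L j) := by
  have hS : IsSelfAdjoint (∑ j, ω j • L j) :=
    isSelfAdjoint_sum _ fun j _ => (IsSelfAdjoint.all (ω j)).smul (hL j)
  have hspec : ∀ j, spectrum ℝ (L j) ⊆ Set.Icc a b := fun j x hx =>
    ⟨(smul_one_le_iff_le_spectrum (hL j)).1 (ha j) x hx,
      (le_smul_one_iff_spectrum_le (hL j)).1 (hb j) x hx⟩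
  obtain ⟨hSa, hSb⟩ := arithmeticMean_mem_bounds hω hω1 ha hb
  have hspecS : spectrum ℝ (∑ j, ω j • L j) ⊆ Set.Icc a b := fun x hx =>
    ⟨(smul_one_le_iff_le_spectrum hS).1 hSa x hx, (le_smul_one_iff_spectrum_le hS).1 hSb x hx⟩
  calc ∑ j, ω j • cfc f (L j) ≤ ∑ j, ω j • (d • (1 : H →L[ℂ] H) + c • L j) := by
        refine Finset.sum_le_sum fun j _ => smul_le_smul_of_nonneg_left ?_ (hω j)
        rw [← cfc_affine (hL j)]
        exact cfc_mono (fun x hx => hfc x (hspec j hx)) (hf.mono (hspec j)) (by fun_prop)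
    _ = d • (1 : H →L[ℂ] H) + c • ∑ j, ω j • L j := by
        simp only [smul_add, Finset.sum_add_distrib, ← Finset.sum_smul, hω1, one_smul,
          Finset.smul_sum, smul_comm c]
    _ ≤ cfc g (∑ j, ω j • L j) := by
        rw [← cfc_affine hS]
        exact cfc_mono (fun x hx => hgc x (hspecS hx)) (by fun_prop) (hg.mono hspecS)

theorem IsStrictlyPositive.of_smul_one_le {T : H →L[ℂ] H} {a : ℝ} (ha : 0 < a)
    (h : a • (1 : H →L[ℂ] H) ≤ T) : IsStrictlyPositive T :=
  (isStrictlyPositive_one.smul ha).of_le h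

/-- The Kantorovich-type complement of the convexity inequality for `x ↦ x ^ (-r)`. -/
theorem sum_rpow_neg_le_kantorovichConst_smul {n : ℕ} {ω : Fin n → ℝ} (hω : ∀ j, 0 ≤ ω j)
    (hω1 : ∑ j, ω j = 1) {B : Fin n → (H →L[ℂ] H)} {a b r : ℝ} (ha0 : 0 < a) (hab : a < b)
    (hr : 0 < r) (ha : ∀ j, a • (1 : H →L[ℂ] H) ≤ B j) (hb : ∀ j, B j ≤ b • (1 : H →L[ℂ] H)) :
    ∑ j, ω j • B j ^ (-r) ≤ kantorovichConst (b / a) (-r) • (∑ j, ω j • B j) ^ (-r) := by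
  have hpos : ∀ j, 0 ≤ B j := fun j => (IsStrictlyPositive.of_smul_one_le ha0 (ha j)).nonneg
  have hS : 0 ≤ ∑ j, ω j • B j := Finset.sum_nonneg fun j _ => smul_nonneg (hω j) (hpos j)
  have hcont : ContinuousOn (fun x : ℝ => x ^ (-r)) (Set.Icc a b) := fun x hx =>
    (Real.continuousAt_rpow_const _ _ (Or.inl (ha0.trans_le hx.1).ne')).continuousWithinAt
  have hSsa : IsSelfAdjoint (∑ j, ω j • B j) := .of_nonneg hS
  have hspecS : spectrum ℝ (∑ j, ω j • B j) ⊆ Set.Icc a b := fun x hx =>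
    ⟨(smul_one_le_iff_le_spectrum hSsa).1 (arithmeticMean_mem_bounds hω hω1 ha hb).1 x hx,
      (le_smul_one_iff_spectrum_le hSsa).1 (arithmeticMean_mem_bounds hω hω1 ha hb).2 x hx⟩
  have hconv : ConvexOn ℝ (Set.Icc a b) fun x : ℝ => x ^ (-r) :=
    (convexOn_rpow_neg hr.le).subset (fun x hx => ha0.trans_le hx.1) (convex_Icc a b)
  set s := (b ^ (-r) - a ^ (-r)) / (b - a) with hs
  rw [CFC.rpow_eq_cfc_real hS, ← cfc_const_mul _ _ _ (hcont.mono hspecS)]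
  simp only [CFC.rpow_eq_cfc_real (hpos _)]
  refine sum_cfc_le_cfc_sum hω hω1 (fun j => .of_nonneg (hpos j)) ha hb hcont
    (continuousOn_const.mul hcont) (d := a ^ (-r) - s * a) (c := s) (fun x hx => ?_) fun x hx => ?_
  · have := hconv.le_chord hab hx
    simp only [← hs] at this
    linarith
  · have hx0 : 0 < x := ha0.trans_le hx.1
    -- Rescaling by `1 / a` moves `[a, b]` to `[1, b / a]`; the factor `a ^ (-r)` undoes it below.
    have h := chord_le_kantorovichConst_mul_rpow ((one_lt_div ha0).2 hab) hr (div_pos hx0 ha0)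
    rw [Real.div_rpow (ha0.trans hab).le ha0.le, Real.div_rpow hx0.le ha0.le] at h
    have hpa : 0 < a ^ (-r) := Real.rpow_pos_of_pos ha0 _
    have hba : b - a ≠ 0 := (sub_pos.2 hab).ne'
    have h' := mul_le_mul_of_nonneg_left h hpa.le
    calc a ^ (-r) - s * a + s * x
        = a ^ (-r) * (1 + (b ^ (-r) / a ^ (-r) - 1) / (b / a - 1) * (x / a - 1)) := by
          rw [hs]; field_simp; ring
      _ ≤ _ := h'.trans_eq (by field_simp)

/-- The Specht-type complement of the convexity inequality for `exp`. -/
theorem sum_exp_le_spechtRatio_smul {n : ℕ} {ω : Fin n → ℝ} (hω : ∀ j, 0 ≤ ω j)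
    (hω1 : ∑ j, ω j = 1) {L : Fin n → (H →L[ℂ] H)} (hL : ∀ j, IsSelfAdjoint (L j)) {a b : ℝ}
    (hab : a < b) (ha : ∀ j, a • (1 : H →L[ℂ] H) ≤ L j) (hb : ∀ j, L j ≤ b • (1 : H →L[ℂ] H)) :
    ∑ j, ω j • NormedSpace.exp (L j) ≤
      spechtRatio (Real.exp (b - a)) • NormedSpace.exp (∑ j, ω j • L j) := by
  have hS : IsSelfAdjoint (∑ j, ω j • L j) :=
    isSelfAdjoint_sum _ fun j _ => (IsSelfAdjoint.all (ω j)).smul (hL j)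
  have hba : 0 < b - a := sub_pos.2 hab
  set s := (Real.exp b - Real.exp a) / (b - a) with hs
  rw [← CFC.real_exp_eq_normedSpace_exp hS, ← cfc_const_mul _ _ _ (by fun_prop)]
  simp only [← CFC.real_exp_eq_normedSpace_exp (hL _)]
  refine sum_cfc_le_cfc_sum hω hω1 hL ha hb (by fun_prop) (by fun_prop)
    (d := Real.exp a - s * a) (c := s) (fun x hx => ?_) fun x hx => ?_
  · have := (convexOn_exp.subset (Set.subset_univ _) (convex_Icc a b)).le_chord hab hx
    simp only [← hs] at this
    linarith
  · have h := chord_le_spechtRatio_mul_exp (Real.one_lt_exp_iff.2 hba) (x - a)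
    rw [Real.log_exp] at h
    have h' := mul_le_mul_of_nonneg_left h (Real.exp_pos a).le
    have e1 : Real.exp b = Real.exp a * Real.exp (b - a) := by rw [← Real.exp_add]; ring_nf
    have e2 : Real.exp x = Real.exp a * Real.exp (x - a) := by rw [← Real.exp_add]; ring_nf
    calc Real.exp a - s * a + s * x
        = Real.exp a * (1 + (Real.exp (b - a) - 1) / (b - a) * (x - a)) := by
          rw [hs, e1]; field_simp; ring
      _ ≤ _ := h'.trans_eq (by rw [e2]; ring)

end MondPecaric

/-! ### Compression identities for commuting idempotents. -/

section RingIdentities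
variable {R : Type*} [Ring R]

theorem Commute.one_sub_conj_eq {P A : R} (h : Commute P A) (hP : IsIdempotentElem P) :
    (1 - P) * A * (1 - P) = A - P * A * P := by
  have h1 : P * A * P = P * A := by rw [mul_assoc, ← h.eq, ← mul_assoc, hP.eq]
  have h2 : (1 - P) * A * (1 - P) = A - A * P - P * A + P * A * P := by noncomm_ring
  rw [h2, h1, ← h.eq]
  abel

theorem Commute.mul_conj_eq {Q E : R} (h : Commute Q E) (X : R) :
    Q * E * X * (Q * E) = E * (Q * X * Q) * E := by
  nth_rw 1 [h.eq]
  simp only [mul_assoc]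

theorem Commute.mul_conj_eq' {Q E : R} (h : Commute Q E) (X : R) :
    Q * E * X * (Q * E) = Q * (E * X * E) * Q := by
  nth_rw 2 [h.eq]
  simp only [mul_assoc]

theorem Commute.conj_idempotent {Q E : R} (h : Commute Q E) (hQ : IsIdempotentElem Q) :
    Q * E * Q = Q * E := by
  rw [mul_assoc, ← h.eq, ← mul_assoc, hQ.eq]

theorem Commute.conj_eq_add {P E D : R} (hPE : Commute P E) (hPD : Commute P D)
    (hP : IsIdempotentElem P) :
    E * D * E = P * E * D * (P * E) + (1 - P) * E * D * ((1 - P) * E) := by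
  have hPED : Commute P (E * D * E) := (hPE.mul_right hPD).mul_right hPE
  rw [hPE.mul_conj_eq', ((Commute.one_left E).sub_left hPE).mul_conj_eq',
    hPED.one_sub_conj_eq hP]
  abel

end RingIdentities

/-! ### Spectral projections and localization of positivity. -/

section SpectralLocalization

variable {H : Type*} [NormedAddCommGroup H] [InnerProductSpace ℂ H] [CompleteSpace H]

/-- `P D P` is `T* T` for `T = √D P`, so the C*-identity gives `T = 0`. -/
theorem IsSelfAdjoint.mul_eq_zero_of_conj_eq_zero {D P : H →L[ℂ] H} (hD : 0 ≤ D)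
    (hP : IsSelfAdjoint P) (h : P * D * P = 0) : D * P = 0 := by
  have hS := CFC.sqrt_mul_sqrt_self D hD
  have hSa : IsSelfAdjoint (CFC.sqrt D) := .of_nonneg (CFC.sqrt_nonneg D)
  have h0 : star (CFC.sqrt D * P) * (CFC.sqrt D * P) = 0 := by
    rw [star_mul, hSa.star_eq, hP.star_eq, ← h, ← mul_assoc, mul_assoc P, hS]
  rw [CStarRing.star_mul_self_eq_zero_iff] at h0
  rw [← hS, mul_assoc, h0, mul_zero]

theorem IsStarProjection.commute_of_mul_eq {P D : H →L[ℂ] H} (hP : IsStarProjection P)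
    (hD : IsSelfAdjoint D) (h : D * P = P * D * P) : Commute P D := by
  have h' := congrArg star h
  simp only [star_mul, hP.isSelfAdjoint.star_eq, hD.star_eq] at h'
  exact h'.trans ((mul_assoc P D P).symm.trans h.symm)

theorem IsStarProjection.conj_le {P A : H →L[ℂ] H} (hP : IsStarProjection P) (hA : 0 ≤ A)
    (h : Commute P A) : P * A * P ≤ A := by
  have h1 : 0 ≤ (1 - P) * A * (1 - P) := hP.one_sub.isSelfAdjoint.conjugate_nonneg hA
  rwa [h.one_sub_conj_eq hP.isIdempotentElem, sub_nonneg] at h1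

/-- Write `C - t = G - N` with positive and negative parts, `G N = 0`. The projection `Q` onto `ker
G` kills `G` and fixes the range of `N`, and an operator commuting with `C` preserves that kernel.
Then `P = 1 - Q` is the required cut at level `t`. -/
theorem exists_isStarProjection_spectral {C : H →L[ℂ] H} (hC : IsSelfAdjoint C) (t : ℝ) :
    ∃ P : H →L[ℂ] H, IsStarProjection P ∧
      (∀ D, IsSelfAdjoint D → Commute D C → Commute P D) ∧
      t • P ≤ P * C * P ∧ (1 - P) * C * (1 - P) ≤ t • (1 - P) := by
  set G := cfc (fun x : ℝ => max (x - t) 0) C with hG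
  set N := cfc (fun x : ℝ => max (t - x) 0) C with hN
  have hGsa : IsSelfAdjoint G := cfc_predicate _ _
  have hG0 : 0 ≤ G := cfc_nonneg fun x _ => le_max_right _ _
  have hN0 : 0 ≤ N := cfc_nonneg fun x _ => le_max_right _ _
  have hGN : G * N = 0 := by
    rw [hG, hN, ← cfc_mul _ _ C (by fun_prop) (by fun_prop), ← cfc_const_zero ℝ C]
    refine cfc_congr fun x _ => ?_
    rcases le_total x t with h | h <;> simp [h]
  have hsub : C - t • (1 : H →L[ℂ] H) = G - N := by
    rw [hG, hN, ← cfc_sub _ _ C (by fun_prop) (by fun_prop)]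
    have : cfc (fun x : ℝ => -t + 1 * x) C = C - t • (1 : H →L[ℂ] H) := by
      rw [cfc_affine hC]; module
    rw [← this]
    refine cfc_congr fun x _ => ?_
    rcases le_total x t with h | h
    · simp [h]; ring
    · simp [h]; ring
  set K : Submodule ℂ H := LinearMap.ker (G : H →ₗ[ℂ] H) with hK
  have hKc : IsClosed (K : Set H) := by
    have : (K : Set H) = G ⁻¹' {0} := by ext x; simp [hK]
    rw [this]; exact isClosed_singleton.preimage G.continuous
  have : CompleteSpace K := hKc.completeSpace_coe
  set Q : H →L[ℂ] H := K.starProjection with hQ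
  have hQp : IsStarProjection Q := isStarProjection_starProjection
  have hQfix : ∀ x, G x = 0 → Q x = x := fun x hx =>
    Submodule.starProjection_eq_self_iff.2 (by simpa [hK] using hx)
  have hGQ : G * Q = 0 := by
    ext x
    have : Q x ∈ K := Submodule.starProjection_apply_mem K x
    simpa [hK] using this
  have hQG : Q * G = 0 := by
    have := congrArg star hGQ
    simpa [star_mul, hQp.isSelfAdjoint.star_eq, hGsa.star_eq] using this
  have hQN : Q * N = N := by
    ext x
    exact hQfix _ (DFunLike.congr_fun hGN x)
  refine ⟨1 - Q, hQp.one_sub, fun D hD hDC => ?_, ?_, ?_⟩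
  · have hDG : Commute D G := (hDC.symm.cfc_real (fun x : ℝ => max (x - t) 0)).symm
    refine (Commute.one_left D).sub_left (hQp.commute_of_mul_eq hD ?_)
    have h0 : G * (D * Q) = 0 := by rw [← mul_assoc, ← hDG.eq, mul_assoc, hGQ, mul_zero]
    ext x
    exact (hQfix _ (DFunLike.congr_fun h0 x)).symm
  · rw [← sub_nonneg]
    have h1 : (1 - Q) * C * (1 - Q) - t • (1 - Q) = (1 - Q) * G * (1 - Q) := by
      have h2 : (1 - Q) * (C - t • (1 : H →L[ℂ] H)) * (1 - Q) =
          (1 - Q) * C * (1 - Q) - t • (1 - Q) := by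
        rw [mul_sub (1 - Q) C, sub_mul ((1 - Q) * C), mul_smul_comm, smul_mul_assoc, mul_one,
          hQp.one_sub.isIdempotentElem.eq]
      rw [← h2, hsub]
      have : (1 - Q) * N = 0 := by rw [sub_mul, one_mul, hQN, sub_self]
      rw [mul_sub (1 - Q) G, sub_mul ((1 - Q) * G), this, zero_mul, sub_zero]
    rw [h1]
    exact hQp.one_sub.isSelfAdjoint.conjugate_nonneg hG0
  · rw [sub_sub_cancel, ← sub_nonneg]
    have h1 : t • Q - Q * C * Q = Q * N * Q := by
      have h2 : Q * (C - t • (1 : H →L[ℂ] H)) * Q = Q * C * Q - t • Q := by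
        rw [mul_sub, sub_mul, mul_smul_comm, smul_mul_assoc, mul_one, hQp.isIdempotentElem.eq]
      rw [← neg_sub, ← h2, hsub, mul_sub, sub_mul, hQG, zero_mul, zero_sub, neg_neg]
    rw [h1]
    exact hQp.isSelfAdjoint.conjugate_nonneg hN0

theorem IsStarProjection.mul_of_commute {P E : H →L[ℂ] H} (hP : IsStarProjection P)
    (hE : IsStarProjection E) (h : Commute P E) : IsStarProjection (P * E) where
  isIdempotentElem := by
    change P * E * (P * E) = P * E
    have := h.mul_conj_eq' 1
    rw [mul_one, mul_one, hE.isIdempotentElem.eq, h.conj_idempotent hP.isIdempotentElem] at this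
    exact this
  isSelfAdjoint := (hP.isSelfAdjoint.commute_iff hE.isSelfAdjoint).1 h

/-- To prove that an operator `D` is positive, it suffices to compress it to the spectral subspaces
of `C` on which `C` is almost scalar. -/
theorem nonneg_of_forall_compression {C D : H →L[ℂ] H} (hC : IsSelfAdjoint C) {a b δ : ℝ}
    (hab : a ≤ b) (hδ : 0 < δ) (ha : a • (1 : H →L[ℂ] H) ≤ C) (hb : C ≤ b • (1 : H →L[ℂ] H))
    (hcomm : ∀ E : H →L[ℂ] H, IsStarProjection E → Commute E C → Commute E D)
    (h : ∀ (E : H →L[ℂ] H) (s t : ℝ), IsStarProjection E → Commute E C → a ≤ s → s ≤ t → t ≤ b →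
      t - s ≤ δ → s • E ≤ E * C * E → E * C * E ≤ t • E → 0 ≤ E * D * E) : 0 ≤ D := by
  have key : ∀ (N : ℕ) (E : H →L[ℂ] H) (s t : ℝ), IsStarProjection E → Commute E C → a ≤ s →
      s ≤ t → t ≤ b → t - s ≤ N * δ → s • E ≤ E * C * E → E * C * E ≤ t • E → 0 ≤ E * D * E := by
    intro N
    induction N with
    | zero =>
      intro E s t hE hEC has hst htb hts
      exact h E s t hE hEC has hst htb (by simp at hts; linarith)
    | succ N ih =>
      intro E s t hE hEC has hst htb hts hsE hEt
      by_cases hsmall : t - s ≤ δ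
      · exact h E s t hE hEC has hst htb hsmall hsE hEt
      -- Cut off the top slice: on `P E` the operator `C` lies in `[t - δ, t]` and `h` applies; on
      -- `(1 - P) E` the interval is shorter by `δ` and induction applies.
      obtain ⟨P, hP, hPcomm, hPl, hPu⟩ := exists_isStarProjection_spectral hC (t - δ)
      have hPC : Commute P C := hPcomm C hC (Commute.refl C)
      have hPE : Commute P E := hPcomm E hE.isSelfAdjoint hEC
      have hQE : Commute (1 - P) E := (Commute.one_left E).sub_left hPE
      have hQC : Commute (1 - P) C := (Commute.one_left C).sub_left hPC
      have n1 : 0 ≤ P * E * D * (P * E) := by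
        refine h (P * E) (t - δ) t (hP.mul_of_commute hE hPE) (hPC.mul_left hEC) (by linarith)
          (by linarith) htb (by linarith) ?_ ?_
        · rw [hPE.mul_conj_eq]
          have := hE.isSelfAdjoint.conjugate_le_conjugate hPl
          rwa [mul_smul_comm, smul_mul_assoc, hPE.symm.conj_idempotent hE.isIdempotentElem, ← hPE.eq] at this
        · rw [hPE.mul_conj_eq']
          have := hP.isSelfAdjoint.conjugate_le_conjugate hEt
          rwa [mul_smul_comm, smul_mul_assoc, hPE.conj_idempotent hP.isIdempotentElem] at this
      have n2 : 0 ≤ (1 - P) * E * D * ((1 - P) * E) := by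
        refine ih ((1 - P) * E) s (t - δ) (hP.one_sub.mul_of_commute hE hQE)
          (hQC.mul_left hEC) has (by linarith) (by linarith)
          (by push_cast at hts; linarith) ?_ ?_
        · rw [hQE.mul_conj_eq']
          have := hP.one_sub.isSelfAdjoint.conjugate_le_conjugate hsE
          rwa [mul_smul_comm, smul_mul_assoc, hQE.conj_idempotent hP.one_sub.isIdempotentElem] at this
        · rw [hQE.mul_conj_eq]
          have := hE.isSelfAdjoint.conjugate_le_conjugate hPu
          rwa [mul_smul_comm, smul_mul_assoc, hQE.symm.conj_idempotent hE.isIdempotentElem, ← hQE.eq] at this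
      rw [hPE.conj_eq_add (hcomm P hP hPC) hP.isIdempotentElem]
      exact add_nonneg n1 n2
  obtain ⟨N, hN⟩ := exists_nat_ge ((b - a) / δ)
  have := key N 1 a b (.one _) (Commute.one_left C) le_rfl hab le_rfl
    ((div_le_iff₀ hδ).1 hN) (by simpa using ha) (by simpa using hb)
  simpa using this

end SpectralLocalization

/-! ### Scalar operators. -/

section ScalarOperators

variable {H : Type*} [NormedAddCommGroup H] [InnerProductSpace ℂ H] [CompleteSpace H]

theorem smul_one_nonneg {t : ℝ} (ht : 0 ≤ t) : 0 ≤ t • (1 : H →L[ℂ] H) :=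
  smul_nonneg ht zero_le_one

omit [CompleteSpace H] in
theorem smul_one_conj (s : ℝ) (A : H →L[ℂ] H) :
    (s • (1 : H →L[ℂ] H)) * A * (s • (1 : H →L[ℂ] H)) = (s * s) • A := by
  rw [smul_mul_assoc, one_mul, mul_smul_comm, mul_one, smul_smul]

theorem smul_one_le_smul_one {s t : ℝ} (h : s ≤ t) :
    s • (1 : H →L[ℂ] H) ≤ t • (1 : H →L[ℂ] H) :=
  smul_le_smul_of_nonneg_right h zero_le_one

theorem smul_one_le_smul_one_iff [Nontrivial H] {s t : ℝ} :
    s • (1 : H →L[ℂ] H) ≤ t • (1 : H →L[ℂ] H) ↔ s ≤ t := by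
  refine ⟨fun h => ?_, smul_one_le_smul_one⟩
  rw [smul_one_le_iff_le_spectrum ((IsSelfAdjoint.all t).smul (.one _)),
    ← Algebra.algebraMap_eq_smul_one, spectrum.scalar_eq] at h
  exact h t rfl

/-- A selfadjoint operator that commutes with all orthogonal projections is a scalar. -/
theorem IsSelfAdjoint.exists_eq_smul_one {T : H →L[ℂ] H} (hT : IsSelfAdjoint T)
    (h : ∀ P : H →L[ℂ] H, IsStarProjection P → Commute P T) :
    ∃ c : ℝ, T = c • (1 : H →L[ℂ] H) := by
  have hlin : ∃ a : ℂ, (T : H →ₗ[ℂ] H) = a • 1 := by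
    -- Commuting with the projection onto the line of `v` makes `v` an eigenvector.
    refine LinearMap.exists_eq_smul_id_of_forall_notLinearIndependent fun v hv => ?_
    have hv0 : v ≠ 0 := by simpa using hv.ne_zero 0
    have hP : IsStarProjection (ℂ ∙ v).starProjection := isStarProjection_starProjection
    have hfix : (ℂ ∙ v).starProjection v = v :=
      Submodule.starProjection_eq_self_iff.2 (Submodule.mem_span_singleton_self v)
    have hTv : (ℂ ∙ v).starProjection (T v) = T v := by
      have := DFunLike.congr_fun (h _ hP).eq v
      simpa [hfix] using this
    obtain ⟨c, hc⟩ := Submodule.mem_span_singleton.1 (Submodule.starProjection_eq_self_iff.1 hTv)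
    rw [LinearIndependent.pair_iff] at hv
    have := (hv c (-1) (by simp [hc])).2
    norm_num at this
  obtain ⟨a, ha⟩ := hlin
  have hTa : T = a • (1 : H →L[ℂ] H) := by
    ext x
    exact DFunLike.congr_fun ha x
  rcases subsingleton_or_nontrivial H with hH | hH
  · exact ⟨0, Subsingleton.elim _ _⟩
  · refine ⟨a.re, ?_⟩
    have h1 := hT.star_eq
    rw [hTa, star_smul, star_one] at h1
    have h2 : star a = a := smul_left_injective ℂ (one_ne_zero (α := H →L[ℂ] H)) h1
    rw [hTa]
    nth_rw 1 [← Complex.conj_eq_iff_re.1 h2]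
    rfl

end ScalarOperators

/-! ### Operator means: congruence, locality and the representing function. -/

namespace IsOperatorMean

variable {H : Type*} [NormedAddCommGroup H] [InnerProductSpace ℂ H] [CompleteSpace H]
  {σ : (H →L[ℂ] H) → (H →L[ℂ] H) → (H →L[ℂ] H)}

/-- The reverse inequality is the transformer inequality for `C⁻¹`, conjugated back by `C`. -/
theorem conj_eq (hσ : IsOperatorMean σ) {A B C : H →L[ℂ] H} (hA : 0 ≤ A) (hB : 0 ≤ B)
    (hC : IsStrictlyPositive C) : C * σ A B * C = σ (C * A * C) (C * B * C) := by
  have hCs : IsSelfAdjoint C := hC.isSelfAdjoint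
  refine le_antisymm (hσ.transformer A B C hA hB hC.nonneg) ?_
  obtain ⟨u, rfl⟩ := hC.isUnit
  have hD := CFC.inv_nonneg_of_nonneg u hC.nonneg
  have h := hσ.transformer _ _ _ (hCs.conjugate_nonneg hA) (hCs.conjugate_nonneg hB) hD
  simp only [mul_assoc, Units.mul_inv, mul_one, Units.inv_mul_cancel_left] at h
  have h' := hCs.conjugate_le_conjugate h
  simp only [mul_assoc, Units.inv_mul, mul_one, Units.mul_inv_cancel_left] at h'
  simpa only [mul_assoc] using h'

theorem smul_eq (hσ : IsOperatorMean σ) {A B : H →L[ℂ] H} (hA : 0 ≤ A) (hB : 0 ≤ B) {t : ℝ}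
    (ht : 0 < t) : σ (t • A) (t • B) = t • σ A B := by
  have h := hσ.conj_eq hA hB (isStrictlyPositive_one.smul (Real.sqrt_pos.2 ht))
  simpa only [smul_one_conj, Real.mul_self_sqrt ht.le] using h.symm

theorem smul_self (hσ : IsOperatorMean σ) {t : ℝ} (ht : 0 < t) :
    σ (t • 1) (t • 1) = t • (1 : H →L[ℂ] H) := by
  rw [hσ.smul_eq zero_le_one zero_le_one ht, hσ.normalized]

/-- A mean of operators that commute with a projection `P` is local with respect to `P`. -/
theorem conj_projection (hσ : IsOperatorMean σ) {A B P : H →L[ℂ] H} (hA : 0 ≤ A) (hB : 0 ≤ B)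
    (hP : IsStarProjection P) (hPA : Commute P A) (hPB : Commute P B) :
    P * σ A B * P = P * σ (P * A * P) (P * B * P) * P ∧ Commute P (σ A B) := by
  have hPs := hP.isSelfAdjoint
  have hPP : ∀ X : H →L[ℂ] H, P * (P * X * P) * P = P * X * P := fun X => by
    simp only [← mul_assoc, hP.isIdempotentElem.eq]
    simp only [mul_assoc, hP.isIdempotentElem.eq]
  have hA' := hPs.conjugate_nonneg hA
  have hB' := hPs.conjugate_nonneg hB
  have h1 := hσ.transformer A B P hA hB hP.nonneg
  have h2 : σ (P * A * P) (P * B * P) ≤ σ A B :=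
    hσ.mono _ _ _ _ hA' hB' (hP.conj_le hA hPA) (hP.conj_le hB hPB)
  refine ⟨le_antisymm ?_ (hPs.conjugate_le_conjugate h2), ?_⟩
  · have := hPs.conjugate_le_conjugate h1
    rwa [hPP] at this
  · have hT : IsSelfAdjoint (σ A B) := .of_nonneg (hσ.nonneg A B hA hB)
    refine hP.commute_of_mul_eq hT (sub_eq_zero.1 ?_)
    -- By `h1` and `h2` the difference is positive. Its compression to `P` vanishes, so it
    -- annihilates `P`.
    have h3 : (σ A B - P * σ A B * P) * P = 0 := by
      refine IsSelfAdjoint.mul_eq_zero_of_conj_eq_zero (sub_nonneg.2 (h1.trans h2)) hPs ?_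
      rw [mul_sub P, sub_mul (P * σ A B), hPP, sub_self]
    rw [sub_mul (σ A B), mul_assoc (P * σ A B), hP.isIdempotentElem.eq] at h3
    exact h3

/-- The representing function of an operator mean. -/
theorem exists_representing (hσ : IsOperatorMean σ) :
    ∃ f : ℝ → ℝ, ∀ t, 0 < t → σ 1 (t • 1) = f t • (1 : H →L[ℂ] H) := by
  have h : ∀ t : ℝ, ∃ c : ℝ, 0 < t → σ 1 (t • 1) = c • (1 : H →L[ℂ] H) := fun t => by
    by_cases ht : 0 < t
    · obtain ⟨c, hc⟩ := IsSelfAdjoint.exists_eq_smul_one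
        (.of_nonneg (hσ.nonneg 1 (t • 1) zero_le_one (smul_one_nonneg ht.le)))
        fun P hP => (hσ.conj_projection zero_le_one (smul_one_nonneg ht.le) hP (Commute.one_right P)
          ((Commute.one_right P).smul_right t)).2
      exact ⟨c, fun _ => hc⟩
    · exact ⟨0, fun h => absurd h ht⟩
  choose f hf using h
  exact ⟨f, hf⟩

section Representing

variable {f : ℝ → ℝ}

omit [CompleteSpace H] in
theorem representing_one [Nontrivial H] (hσ : IsOperatorMean σ)
    (hf : ∀ t, 0 < t → σ 1 (t • 1) = f t • (1 : H →L[ℂ] H)) : f 1 = 1 := by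
  have := hf 1 one_pos
  rw [one_smul, hσ.normalized, eq_comm] at this
  exact smul_left_injective ℝ (one_ne_zero (α := H →L[ℂ] H)) (by simpa using this)

theorem representing_mono [Nontrivial H] (hσ : IsOperatorMean σ)
    (hf : ∀ t, 0 < t → σ 1 (t • 1) = f t • (1 : H →L[ℂ] H)) {s t : ℝ} (hs : 0 < s) (hst : s ≤ t) :
    f s ≤ f t := by
  rw [← smul_one_le_smul_one_iff (H := H), ← hf s hs, ← hf t (hs.trans_le hst)]
  exact hσ.mono _ _ _ _ zero_le_one (smul_one_nonneg hs.le) le_rfl (smul_one_le_smul_one hst)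

/-- By homogeneity, `l f(t)` belongs to the mean of `l • 1` and `(l t) • 1`, whose first argument
exceeds `1`. -/
theorem representing_mul_le [Nontrivial H] (hσ : IsOperatorMean σ)
    (hf : ∀ t, 0 < t → σ 1 (t • 1) = f t • (1 : H →L[ℂ] H)) {l t : ℝ} (hl : 1 ≤ l) (ht : 0 < t) :
    f (l * t) ≤ l * f t := by
  have hl0 : 0 < l := by linarith
  rw [← smul_one_le_smul_one_iff (H := H), mul_smul, ← hf t ht, ← hf _ (mul_pos hl0 ht),
    ← hσ.smul_eq zero_le_one (smul_one_nonneg ht.le) hl0, ← mul_smul]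
  exact hσ.mono _ _ _ _ zero_le_one (smul_one_nonneg (by positivity))
    (by simpa using smul_one_le_smul_one (H := H) hl) le_rfl

theorem representing_pos [Nontrivial H] (hσ : IsOperatorMean σ)
    (hf : ∀ t, 0 < t → σ 1 (t • 1) = f t • (1 : H →L[ℂ] H)) {t : ℝ} (ht : 0 < t) : 0 < f t := by
  have h1 := hσ.representing_one hf
  rcases le_total t 1 with h | h
  · have := hσ.representing_mul_le hf ((one_le_div ht).2 h) ht
    rw [div_mul_cancel₀ _ ht.ne', h1] at this
    by_contra hc
    have := mul_nonpos_of_nonneg_of_nonpos (one_div_pos.2 ht).le (not_lt.1 hc)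
    linarith
  · have := hσ.representing_mono hf one_pos h
    linarith

theorem conj_smul_one (c : ℝ) {E : H →L[ℂ] H} (hE : IsStarProjection E) :
    E * (c • (1 : H →L[ℂ] H)) * E = c • E := by
  rw [mul_smul_comm, smul_mul_assoc, mul_one, hE.isIdempotentElem.eq]

/-- With `le_compression`, this replaces the functional calculus: on a subspace where `C` lies
between `s` and `t`, the mean `σ 1 C` lies between `f s` and `f t`. Locality allows compressing the
arguments first; here they are then enlarged to scalars by `E ≤ 1`. -/
theorem compression_le (hσ : IsOperatorMean σ)
    (hf : ∀ t, 0 < t → σ 1 (t • 1) = f t • (1 : H →L[ℂ] H)) {C E : H →L[ℂ] H} (hC : 0 ≤ C)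
    (hE : IsStarProjection E) (hEC : Commute E C) {t : ℝ} (ht : 0 < t)
    (h : E * C * E ≤ t • E) : E * σ 1 C * E ≤ f t • E := by
  rw [(hσ.conj_projection zero_le_one hC hE (Commute.one_right E) hEC).1,
    ← conj_smul_one (f t) hE, ← hf t ht]
  refine hE.isSelfAdjoint.conjugate_le_conjugate (hσ.mono _ _ _ _
    (hE.isSelfAdjoint.conjugate_nonneg zero_le_one) (hE.isSelfAdjoint.conjugate_nonneg hC) ?_
    (h.trans (smul_le_smul_of_nonneg_left hE.le_one ht.le)))
  rw [mul_one, hE.isIdempotentElem.eq]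
  exact hE.le_one

theorem le_compression (hσ : IsOperatorMean σ)
    (hf : ∀ t, 0 < t → σ 1 (t • 1) = f t • (1 : H →L[ℂ] H)) {C E : H →L[ℂ] H} (hC : 0 ≤ C)
    (hE : IsStarProjection E) (hEC : Commute E C) {s : ℝ} (hs : 0 < s)
    (h : s • E ≤ E * C * E) : f s • E ≤ E * σ 1 C * E := by
  rw [(hσ.conj_projection zero_le_one hC hE (Commute.one_right E) hEC).1,
    ← conj_smul_one (f s) hE, ← hf s hs,
    (hσ.conj_projection zero_le_one (smul_one_nonneg hs.le) hE (Commute.one_right E)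
      ((Commute.one_right E).smul_right s)).1, conj_smul_one s hE]
  exact hE.isSelfAdjoint.conjugate_le_conjugate (hσ.mono _ _ _ _
    (hE.isSelfAdjoint.conjugate_nonneg zero_le_one) (smul_nonneg hs.le hE.nonneg) le_rfl h)

/-- The mean of the identity and an operator with at most two spectral values. -/
theorem one_two_valued (hσ : IsOperatorMean σ)
    (hf : ∀ t, 0 < t → σ 1 (t • 1) = f t • (1 : H →L[ℂ] H)) {P : H →L[ℂ] H}
    (hP : IsStarProjection P) {a b : ℝ} (ha : 0 < a) (hb : 0 < b) :
    σ 1 (a • P + b • (1 - P)) = f a • P + f b • (1 - P) := by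
  have hC : 0 ≤ a • P + b • (1 - P) :=
    add_nonneg (smul_nonneg ha.le hP.nonneg) (smul_nonneg hb.le hP.one_sub.nonneg)
  have hPP : Commute P (1 - P) := (Commute.one_right P).sub_right (Commute.refl P)
  have hPC : Commute P (a • P + b • (1 - P)) :=
    ((Commute.refl P).smul_right a).add_right (hPP.smul_right b)
  have hQC : Commute (1 - P) (a • P + b • (1 - P)) := (Commute.one_left _).sub_left hPC
  have eP : P * (a • P + b • (1 - P)) * P = a • P := by
    rw [mul_add P, mul_smul_comm, mul_smul_comm, hP.mul_one_sub_self, smul_zero, add_zero,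
      smul_mul_assoc, hP.isIdempotentElem.eq, hP.isIdempotentElem.eq]
  have eQ : (1 - P) * (a • P + b • (1 - P)) * (1 - P) = b • (1 - P) := by
    rw [mul_add (1 - P), mul_smul_comm, mul_smul_comm, hP.one_sub_mul_self, smul_zero, zero_add,
      smul_mul_assoc, hP.one_sub.isIdempotentElem.eq, hP.one_sub.isIdempotentElem.eq]
  have h1 : P * σ 1 (a • P + b • (1 - P)) * P = f a • P :=
    le_antisymm (hσ.compression_le hf hC hP hPC ha eP.le) (hσ.le_compression hf hC hP hPC ha eP.ge)
  have h2 : (1 - P) * σ 1 (a • P + b • (1 - P)) * (1 - P) = f b • (1 - P) :=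
    le_antisymm (hσ.compression_le hf hC hP.one_sub hQC hb eQ.le)
      (hσ.le_compression hf hC hP.one_sub hQC hb eQ.ge)
  rw [← h1, ← h2,
    (hσ.conj_projection zero_le_one hC hP (Commute.one_right P) hPC).2.one_sub_conj_eq
      hP.isIdempotentElem, add_sub_cancel]

end Representing

end IsOperatorMean

/-! ### Two projections in general position and concavity from monotonicity. -/

section TwoProjections

variable {H : Type*} [NormedAddCommGroup H] [InnerProductSpace ℂ H] [CompleteSpace H]

omit [CompleteSpace H] in
-- This is where the dimension hypothesis acts. `Module.finrank` is 0 in infinite dimension, so for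
-- a nontrivial space `≠ 1` says that the dimension is at least two, possibly infinite.
theorem exists_orthonormal_pair [Nontrivial H] (hH : Module.finrank ℂ H ≠ 1) :
    ∃ e₁ e₂ : H, ‖e₁‖ = 1 ∧ ‖e₂‖ = 1 ∧ inner ℂ e₁ e₂ = 0 := by
  obtain ⟨v, hv⟩ := exists_ne (0 : H)
  have hnot : ∃ w : H, w ∉ (ℂ ∙ v) := by
    by_contra hc
    push Not at hc
    exact hH (finrank_eq_one v hv fun w => Submodule.mem_span_singleton.1 (hc w))
  obtain ⟨w, hw⟩ := hnot
  set z := w - (ℂ ∙ v).starProjection w with hz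
  have hz0 : z ≠ 0 := fun h => hw <| by
    rw [sub_eq_zero.1 (hz.symm.trans h)]
    exact Submodule.starProjection_apply_mem _ w
  have hvz : inner ℂ v z = 0 :=
    (Submodule.sub_starProjection_mem_orthogonal w) v (Submodule.mem_span_singleton_self v)
  refine ⟨(‖v‖⁻¹ : ℂ) • v, (‖z‖⁻¹ : ℂ) • z, ?_, ?_, ?_⟩
  · exact_mod_cast norm_smul_inv_norm (𝕜 := ℂ) hv
  · exact_mod_cast norm_smul_inv_norm (𝕜 := ℂ) hz0
  · rw [inner_smul_left, inner_smul_right, hvz, mul_zero, mul_zero]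

/-- Two lines at a prescribed angle. -/
theorem exists_projections_compression_eq [Nontrivial H] (hH : Module.finrank ℂ H ≠ 1) {a b : ℝ}
    (ha : 0 ≤ a) (hb : 0 ≤ b) (hab : a + b = 1) :
    ∃ P Q : H →L[ℂ] H, IsStarProjection P ∧ IsStarProjection Q ∧ Q ≠ 0 ∧ Q * P * Q = a • Q := by
  obtain ⟨e₁, e₂, h₁, h₂, h₁₂⟩ := exists_orthonormal_pair hH
  -- A unit vector because `a + b = 1`. The projections are onto `e₁` and `u`, and `Q P Q = |⟨e₁,
  -- u⟩|² Q = a Q`.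
  set u : H := (√a : ℂ) • e₁ + (√b : ℂ) • e₂ with hu
  have h11 : inner ℂ e₁ e₁ = (1 : ℂ) := by simp [inner_self_eq_norm_sq_to_K, h₁]
  have h22 : inner ℂ e₂ e₂ = (1 : ℂ) := by simp [inner_self_eq_norm_sq_to_K, h₂]
  have h21 : inner ℂ e₂ e₁ = (0 : ℂ) := inner_eq_zero_symm.1 h₁₂
  have h1u : inner ℂ e₁ u = (√a : ℂ) := by
    rw [hu, inner_add_right, inner_smul_right, inner_smul_right, h11, h₁₂]; simp
  have hu1 : inner ℂ u e₁ = (√a : ℂ) := by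
    rw [← inner_conj_symm, h1u, Complex.conj_ofReal]
  have hsa : (√a : ℂ) * (√a : ℂ) = (a : ℂ) := by exact_mod_cast Real.mul_self_sqrt ha
  have hsb : (√b : ℂ) * (√b : ℂ) = (b : ℂ) := by exact_mod_cast Real.mul_self_sqrt hb
  have huu : inner ℂ u u = (1 : ℂ) := by
    have h2u : inner ℂ e₂ u = (√b : ℂ) := by
      rw [hu, inner_add_right, inner_smul_right, inner_smul_right, h22, h21]; simp
    nth_rw 1 [hu]
    rw [inner_add_left, inner_smul_left, inner_smul_left, h1u, h2u, Complex.conj_ofReal,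
      Complex.conj_ofReal, hsa, hsb]
    exact_mod_cast hab
  have hun : ‖u‖ = 1 := by
    have := inner_self_eq_norm_sq (𝕜 := ℂ) u
    rw [huu] at this
    have h' : ‖u‖ ^ 2 = 1 := by simpa using this.symm
    exact (pow_eq_one_iff_of_nonneg (norm_nonneg u) two_ne_zero).1 h'
  refine ⟨InnerProductSpace.rankOne ℂ e₁ e₁, InnerProductSpace.rankOne ℂ u u,
    InnerProductSpace.isStarProjection_rankOne_self h₁,
    InnerProductSpace.isStarProjection_rankOne_self hun, fun h0 => ?_, ?_⟩
  · have := DFunLike.congr_fun h0 u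
    simp only [InnerProductSpace.rankOne_apply, huu, one_smul, zero_apply] at this
    rw [this, norm_zero] at hun
    exact zero_ne_one hun
  · ext x
    change InnerProductSpace.rankOne ℂ u u (InnerProductSpace.rankOne ℂ e₁ e₁
      (InnerProductSpace.rankOne ℂ u u x)) = a • InnerProductSpace.rankOne ℂ u u x
    simp only [InnerProductSpace.rankOne_apply, inner_smul_right, hu1, h1u]
    rw [mul_assoc, hsa, mul_comm, mul_smul]
    rfl

theorem IsStarProjection.le_of_smul_le_smul {Q : H →L[ℂ] H} (hQ : IsStarProjection Q) (hQ0 : Q ≠ 0)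
    {s t : ℝ} (h : s • Q ≤ t • Q) : s ≤ t := by
  by_contra! hlt
  have h1 : 0 ≤ (s - t) • Q := smul_nonneg (by linarith) hQ.nonneg
  have h2 : (s - t) • Q ≤ 0 := by rw [sub_smul]; exact sub_nonpos.2 h
  rcases smul_eq_zero.1 (le_antisymm h2 h1) with h3 | h3
  · linarith
  · exact hQ0 h3

theorem IsStarProjection.two_valued_conj {Q : H →L[ℂ] H} (hQ : IsStarProjection Q) (s t : ℝ) :
    Q * (s • Q + t • (1 - Q)) * Q = s • Q := by
  rw [mul_add Q, mul_smul_comm, mul_smul_comm, hQ.mul_one_sub_self, smul_zero, add_zero,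
    smul_mul_assoc, hQ.isIdempotentElem.eq, hQ.isIdempotentElem.eq]

/-- A positive operator is dominated by a weighted block diagonal part. -/
theorem le_smul_conj_add_smul_conj {C Q : H →L[ℂ] H} (hC : 0 ≤ C) (hQ : IsSelfAdjoint Q) {η : ℝ}
    (hη : 0 < η) :
    C ≤ (1 + η) • (Q * C * Q) + (1 + η⁻¹) • ((1 - Q) * C * (1 - Q)) := by
  set R := 1 - Q with hR
  have hRs : IsSelfAdjoint R := (IsSelfAdjoint.one _).sub hQ
  set s := √η with hs
  have hs0 : 0 < s := Real.sqrt_pos.2 hη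
  have hss : s * s = η := Real.mul_self_sqrt hη.le
  -- Conjugating `C` by this operator gives a positive operator, which bounds the off-diagonal
  -- blocks by weighted diagonal ones.
  have hX : IsSelfAdjoint (s • Q - s⁻¹ • R) :=
    ((IsSelfAdjoint.all s).smul hQ).sub ((IsSelfAdjoint.all s⁻¹).smul hRs)
  have h := hX.conjugate_nonneg hC
  have hexp : (s • Q - s⁻¹ • R) * C * (s • Q - s⁻¹ • R) =
      (s * s) • (Q * C * Q) + (s * s)⁻¹ • (R * C * R) - Q * C * R - R * C * Q := by
    have e : ∀ X Y : H →L[ℂ] H, (X - Y) * C * (X - Y) = X * C * X + Y * C * Y - X * C * Y -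
        Y * C * X := fun X Y => by noncomm_ring
    rw [e]
    simp only [smul_mul_assoc, mul_smul_comm, smul_smul, mul_inv_cancel₀ hs0.ne',
      inv_mul_cancel₀ hs0.ne', one_smul, mul_inv]
  have hC' : C = Q * C * Q + R * C * R + Q * C * R + R * C * Q := by
    rw [hR]; noncomm_ring
  rw [hexp, hss] at h
  rw [← sub_nonneg]
  calc (0 : H →L[ℂ] H) ≤ η • (Q * C * Q) + η⁻¹ • (R * C * R) - Q * C * R - R * C * Q := h
    _ = (1 + η) • (Q * C * Q) + (1 + η⁻¹) • (R * C * R) -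
        (Q * C * Q + R * C * R + Q * C * R + R * C * Q) := by module
    _ = _ := by rw [← hC']

/-- A function that is operator monotone on operators with two spectral values is concave. -/
theorem concaveOn_of_two_valued_monotone [Nontrivial H] (hH : Module.finrank ℂ H ≠ 1) {f : ℝ → ℝ}
    (hmono : ∀ (P Q : H →L[ℂ] H) (a b c d : ℝ), IsStarProjection P → IsStarProjection Q →
      0 < a → 0 < b → 0 < c → 0 < d → a • P + b • (1 - P) ≤ c • Q + d • (1 - Q) →
      f a • P + f b • (1 - P) ≤ f c • Q + f d • (1 - Q))
    (hscale : ∀ l t, 1 ≤ l → 0 < t → f (l * t) ≤ l * f t) : ConcaveOn ℝ (Set.Ioi 0) f := by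
  refine ⟨convex_Ioi 0, fun x hx y hy a b ha hb hab => ?_⟩
  have hx0 : 0 < x := hx
  have hy0 : 0 < y := hy
  obtain ⟨P, Q, hP, hQ, hQ0, hQPQ⟩ := exists_projections_compression_eq (H := H) hH ha hb hab
  have hcomp : ∀ s t : ℝ, Q * (s • P + t • (1 - P)) * Q = (a * s + b * t) • Q := fun s t => by
    rw [mul_add Q, mul_smul_comm, mul_smul_comm, mul_sub Q, mul_one, add_mul (s • (Q * P)),
      smul_mul_assoc, smul_mul_assoc, sub_mul Q, hQPQ, hQ.isIdempotentElem.eq,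
      eq_sub_of_add_eq' hab]
    module
  simp only [smul_eq_mul]
  have hc0 : 0 < a * x + b * y := by
    rcases ha.eq_or_lt with rfl | ha'
    · have : b = 1 := by linarith
      subst this; simpa using hy0
    · have := mul_pos ha' hx0
      have := mul_nonneg hb hy0.le
      linarith
  -- The operator `x P + y (1 - P)` compresses to `(a x + b y) Q`, so it is dominated by a
  -- two-valued operator for `Q` with value `(1 + η)(a x + b y)` on `Q`. The large value on `1 - Q`,
  -- of order `1 / η`, disappears when the images under `f` are compressed to `Q`; `hscale` then
  -- takes `1 + η` out of `f`.
  have key : ∀ η : ℝ, 0 < η → a * f x + b * f y ≤ (1 + η) * f (a * x + b * y) := fun η hη => by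
    have hC0 : 0 ≤ x • P + y • (1 - P) :=
      add_nonneg (smul_nonneg hx0.le hP.nonneg) (smul_nonneg hy0.le hP.one_sub.nonneg)
    have hCle : x • P + y • (1 - P) ≤ (x + y) • (1 : H →L[ℂ] H) := by
      rw [add_smul]
      exact add_le_add (smul_le_smul_of_nonneg_left hP.le_one hx0.le)
        (smul_le_smul_of_nonneg_left hP.one_sub.le_one hy0.le)
    have hR : (1 - Q) * (x • P + y • (1 - P)) * (1 - Q) ≤ (x + y) • (1 - Q) := by
      have := hQ.one_sub.isSelfAdjoint.conjugate_le_conjugate hCle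
      rwa [IsOperatorMean.conj_smul_one _ hQ.one_sub] at this
    have hle : x • P + y • (1 - P) ≤
        ((1 + η) * (a * x + b * y)) • Q + ((1 + η⁻¹) * (x + y)) • (1 - Q) := by
      refine (le_smul_conj_add_smul_conj hC0 hQ.isSelfAdjoint hη).trans ?_
      rw [hcomp, mul_smul, mul_smul]
      gcongr
    have h1 := hQ.isSelfAdjoint.conjugate_le_conjugate
      (hmono P Q _ _ _ _ hP hQ hx0 hy0 (by positivity) (by positivity) hle)
    rw [hcomp, hQ.two_valued_conj] at h1
    exact (hQ.le_of_smul_le_smul hQ0 h1).trans (hscale _ _ (by linarith) hc0)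
  have hlim : Tendsto (fun η : ℝ => (1 + η) * f (a * x + b * y)) (𝓝[>] 0)
      (𝓝 ((1 + 0) * f (a * x + b * y))) :=
    ((continuous_const.add continuous_id).mul continuous_const).continuousAt.tendsto.mono_left
      nhdsWithin_le_nhds
  have := ge_of_tendsto hlim (eventually_mem_nhdsWithin.mono key)
  simpa using this

theorem IsStarProjection.min_smul_one_le {P : H →L[ℂ] H} (hP : IsStarProjection P) (a b : ℝ) :
    min a b • (1 : H →L[ℂ] H) ≤ a • P + b • (1 - P) := by
  have h : min a b • (1 : H →L[ℂ] H) = min a b • P + min a b • (1 - P) := by module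
  rw [h]
  exact add_le_add (smul_le_smul_of_nonneg_right (min_le_left _ _) hP.nonneg)
    (smul_le_smul_of_nonneg_right (min_le_right _ _) hP.one_sub.nonneg)

theorem IsStarProjection.two_valued_strictlyPositive {P : H →L[ℂ] H} (hP : IsStarProjection P)
    {a b : ℝ} (ha : 0 < a) (hb : 0 < b) : IsStrictlyPositive (a • P + b • (1 - P)) :=
  .of_smul_one_le (lt_min ha hb) (hP.min_smul_one_le a b)

theorem IsStarProjection.inverse_two_valued {P : H →L[ℂ] H} (hP : IsStarProjection P)
    {a b : ℝ} (ha : 0 < a) (hb : 0 < b) :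
    Ring.inverse (a • P + b • (1 - P)) = a⁻¹ • P + b⁻¹ • (1 - P) := by
  rw [← one_mul (Ring.inverse _), eq_comm,
    Ring.eq_mul_inverse_iff_mul_eq _ _ _ (hP.two_valued_strictlyPositive ha hb).isUnit]
  simp only [mul_add, add_mul, smul_mul_smul_comm, hP.mul_one_sub_self, hP.one_sub_mul_self,
    hP.isIdempotentElem.eq, hP.one_sub.isIdempotentElem.eq, inv_mul_cancel₀ ha.ne',
    inv_mul_cancel₀ hb.ne', smul_zero, one_smul, add_zero, zero_add, add_sub_cancel]

end TwoProjections

/-! ### Concave functions on the half-line. -/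

section ConcaveFunctions

/-- A zero slope on `[a, b]` makes all later slopes nonpositive by concavity, and monotonicity makes
them nonnegative. -/
theorem ConcaveOn.eq_of_eq_of_le {F : ℝ → ℝ} (hF : ConcaveOn ℝ (Set.Ioi 0) F)
    (hmono : ∀ s t, 0 < s → s ≤ t → F s ≤ F t) {a b t : ℝ} (ha : 0 < a) (hab : a < b)
    (h : F a = F b) (ht : b ≤ t) : F t = F b := by
  refine le_antisymm ?_ (hmono _ _ (ha.trans hab) ht)
  rcases ht.eq_or_lt with rfl | ht
  · exact le_rfl
  have := hF.slope_anti_adjacent ha (ha.trans (hab.trans ht)) hab ht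
  rw [h, sub_self, zero_div, div_nonpos_iff] at this
  rcases this with h' | h' <;> linarith

/-- A nonconstant function `f` such that `f` and its adjoint `s ↦ 1 / f (1 / s)` are both concave
is strictly increasing. -/
theorem ConcaveOn.lt_of_adjoint_concaveOn {f : ℝ → ℝ} (hf : ConcaveOn ℝ (Set.Ioi 0) f)
    (hg : ConcaveOn ℝ (Set.Ioi 0) fun s => (f s⁻¹)⁻¹)
    (hmono : ∀ s t, 0 < s → s ≤ t → f s ≤ f t) (hpos : ∀ t, 0 < t → 0 < f t)
    (hne : ∃ t, 0 < t ∧ f t ≠ f 1) {a b : ℝ} (ha : 0 < a) (hab : a < b) : f a < f b := by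
  refine lt_of_le_of_ne (hmono a b ha hab.le) fun heq => ?_
  have hb : 0 < b := ha.trans hab
  have hgmono : ∀ s t, 0 < s → s ≤ t → (f s⁻¹)⁻¹ ≤ (f t⁻¹)⁻¹ := fun s t hs hst =>
    inv_anti₀ (hpos _ (inv_pos.2 (hs.trans_le hst)))
      (hmono _ _ (inv_pos.2 (hs.trans_le hst)) (inv_anti₀ hs hst))
  have h1 : ∀ t, b ≤ t → f t = f b := fun t ht => hf.eq_of_eq_of_le hmono ha hab heq ht
  -- The adjoint exchanges large and small arguments: `f (2 b) = f b` makes it constant beyond `1 /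
  -- b`, so `f` is constant on `(0, b]` too.
  have h2 : ∀ t, 0 < t → f t = f b := fun t ht => by
    rcases le_total b t with h | h
    · exact h1 t h
    · have hb2 : f (2 * b) = f b := h1 _ (by linarith)
      have := hg.eq_of_eq_of_le hgmono (a := (2 * b)⁻¹) (b := b⁻¹) (t := t⁻¹) (by positivity)
        (inv_strictAnti₀ hb (by linarith)) (by simp only [inv_inv, hb2]) (inv_anti₀ ht h)
      simpa using this
  obtain ⟨t, ht, htne⟩ := hne
  exact htne ((h2 t ht).trans (h2 1 one_pos).symm)

/-- Take `α` to be the infimum of the slopes to the left of 1. It dominates every slope to the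
right, in particular `f 2 - 1 > 0`. -/
theorem ConcaveOn.exists_pos_slope {f : ℝ → ℝ} (hf : ConcaveOn ℝ (Set.Ioi 0) f) (h1 : f 1 = 1)
    (h2 : 1 < f 2) : ∃ α : ℝ, 0 < α ∧ ∀ t, 0 < t → f t ≤ 1 + α * (t - 1) := by
  set L := (fun s => (1 - f s) / (1 - s)) '' Set.Ioo 0 1 with hL
  have hne : L.Nonempty := ⟨_, 2⁻¹, by norm_num, rfl⟩
  have hlow : ∀ t, 1 < t → ∀ l ∈ L, (f t - 1) / (t - 1) ≤ l := by
    rintro t ht _ ⟨s, hs, rfl⟩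
    have := hf.slope_anti_adjacent (x := s) (y := 1) (z := t) hs.1
      (Set.mem_Ioi.2 (by linarith)) hs.2 ht
    rwa [h1] at this
  have hbdd : BddBelow L := ⟨_, hlow 2 (by norm_num)⟩
  refine ⟨sInf L, ?_, fun t ht => ?_⟩
  · have := le_csInf hne (hlow 2 (by norm_num))
    norm_num at this
    linarith
  · rcases lt_trichotomy t 1 with h | rfl | h
    · have := csInf_le hbdd ⟨t, ⟨ht, h⟩, rfl⟩
      rw [le_div_iff₀ (by linarith)] at this
      linarith
    · simp [h1]
    · have := le_csInf hne (hlow t h)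
      rw [div_le_iff₀ (by linarith)] at this
      linarith

end ConcaveFunctions

/-! ### Scalar bounds and inverses. -/

section Inverses

variable {H : Type*} [NormedAddCommGroup H] [InnerProductSpace ℂ H] [CompleteSpace H]

theorem IsStrictlyPositive.exists_smul_one_bounds [Nontrivial H] {C : H →L[ℂ] H}
    (hC : IsStrictlyPositive C) : ∃ a b : ℝ, 0 < a ∧ a ≤ b ∧ a • (1 : H →L[ℂ] H) ≤ C ∧
      C ≤ b • (1 : H →L[ℂ] H) := by
  obtain ⟨a, ha, haC⟩ := (CFC.exists_pos_algebraMap_le_iff hC.isSelfAdjoint).2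
    fun x hx => hC.spectrum_pos hx
  have hb := hC.isSelfAdjoint.le_algebraMap_norm_self
  rw [Algebra.algebraMap_eq_smul_one] at haC hb
  exact ⟨a, ‖C‖, ha, smul_one_le_smul_one_iff.1 (haC.trans hb), haC, hb⟩

omit [CompleteSpace H] in
theorem IsUnit.ringInverse_conj {R T : H →L[ℂ] H} (hR : IsUnit R) :
    Ring.inverse (R * T * R) = Ring.inverse R * Ring.inverse T * Ring.inverse R := by
  rw [Ring.inverse_mul (Or.inr hR), Ring.inverse_mul (Or.inl hR), mul_assoc]

omit [CompleteSpace H] in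
theorem Ring.inverse_smul {C : H →L[ℂ] H} (hC : IsUnit C) {c : ℝ} (hc : c ≠ 0) :
    Ring.inverse (c • C) = c⁻¹ • Ring.inverse C := by
  have hcC : IsUnit (c • C) := hC.smul (Units.mk0 c hc)
  rw [← one_mul (Ring.inverse _), eq_comm, Ring.eq_mul_inverse_iff_mul_eq _ _ _ hcC,
    smul_mul_smul_comm, inv_mul_cancel₀ hc, one_smul, Ring.inverse_mul_cancel _ hC]

omit [CompleteSpace H] in
theorem Commute.ringInverse {E T : H →L[ℂ] H} (h : Commute E T) : Commute E (Ring.inverse T) := by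
  by_cases hT : IsUnit T
  · obtain ⟨u, rfl⟩ := hT
    rw [Ring.inverse_unit]
    exact h.units_inv_right
  · rw [Ring.inverse_non_unit _ hT]
    exact Commute.zero_right E

/-- Multiply the positive operator `E T E - c E` by `T⁻¹`, with which it commutes; the product is
still positive. -/
theorem IsStrictlyPositive.inverse_compression_le {T E : H →L[ℂ] H} (hT : IsStrictlyPositive T)
    (hE : IsStarProjection E) (hET : Commute E T) {c : ℝ} (hc : 0 < c) (h : c • E ≤ E * T * E) :
    E * Ring.inverse T * E ≤ c⁻¹ • E := by
  have hEV := hET.ringInverse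
  have e1 : E * T * E = E * T := by rw [mul_assoc, ← hET.eq, ← mul_assoc, hE.isIdempotentElem.eq]
  have e2 : E * Ring.inverse T * E = E * Ring.inverse T := by
    rw [mul_assoc, ← hEV.eq, ← mul_assoc, hE.isIdempotentElem.eq]
  have hcomm : Commute (E * T - c • E) (Ring.inverse T) :=
    (hEV.mul_left (Commute.refl T).ringInverse).sub_left (hEV.smul_left c)
  rw [e1, ← sub_nonneg] at h
  have h2 := hcomm.mul_nonneg h hT.ringInverse.nonneg
  rw [sub_mul (E * T), mul_assoc, Ring.mul_inverse_cancel _ hT.isUnit, mul_one, smul_mul_assoc,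
    sub_nonneg] at h2
  rw [e2]
  have h3 := smul_le_smul_of_nonneg_left h2 (inv_pos.2 hc).le
  rwa [smul_smul, inv_mul_cancel₀ hc.ne', one_smul] at h3

theorem IsStrictlyPositive.le_inverse_compression {T E : H →L[ℂ] H} (hT : IsStrictlyPositive T)
    (hE : IsStarProjection E) (hET : Commute E T) {c : ℝ} (hc : 0 < c) (h : E * T * E ≤ c • E) :
    c⁻¹ • E ≤ E * Ring.inverse T * E := by
  have hEV := hET.ringInverse
  have e1 : E * T * E = E * T := by rw [mul_assoc, ← hET.eq, ← mul_assoc, hE.isIdempotentElem.eq]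
  have e2 : E * Ring.inverse T * E = E * Ring.inverse T := by
    rw [mul_assoc, ← hEV.eq, ← mul_assoc, hE.isIdempotentElem.eq]
  have hcomm : Commute (c • E - E * T) (Ring.inverse T) :=
    (hEV.smul_left c).sub_left (hEV.mul_left (Commute.refl T).ringInverse)
  rw [e1, ← sub_nonneg] at h
  have h2 := hcomm.mul_nonneg h hT.ringInverse.nonneg
  rw [sub_mul (c • E), mul_assoc E, Ring.mul_inverse_cancel _ hT.isUnit, mul_one, smul_mul_assoc,
    sub_nonneg] at h2
  rw [e2]
  have h3 := smul_le_smul_of_nonneg_left h2 (inv_pos.2 hc).le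
  rwa [smul_smul, inv_mul_cancel₀ hc.ne', one_smul] at h3

theorem nonneg_of_forall_pos_add_smul_one {D : H →L[ℂ] H}
    (h : ∀ δ : ℝ, 0 < δ → 0 ≤ D + δ • (1 : H →L[ℂ] H)) : 0 ≤ D := by
  have hlim : Tendsto (fun δ : ℝ => D + δ • (1 : H →L[ℂ] H)) (𝓝[>] 0)
      (𝓝 (D + (0 : ℝ) • (1 : H →L[ℂ] H))) :=
    (continuous_const.add (continuous_id.smul continuous_const)).continuousAt.tendsto.mono_left
      nhdsWithin_le_nhds
  have := ge_of_tendsto hlim (eventually_mem_nhdsWithin.mono h)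
  simpa using this

end Inverses

/-! ### From the representing function to operator estimates. -/

namespace IsOperatorMean

variable {H : Type*} [NormedAddCommGroup H] [InnerProductSpace ℂ H] [CompleteSpace H]
  {σ : (H →L[ℂ] H) → (H →L[ℂ] H) → (H →L[ℂ] H)}

theorem strictlyPositive [Nontrivial H] (hσ : IsOperatorMean σ) {A B : H →L[ℂ] H}
    (hA : IsStrictlyPositive A) (hB : IsStrictlyPositive B) : IsStrictlyPositive (σ A B) := by
  obtain ⟨a, -, ha, -, haA, -⟩ := hA.exists_smul_one_bounds
  obtain ⟨b, -, hb, -, hbB, -⟩ := hB.exists_smul_one_bounds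
  refine .of_smul_one_le (lt_min ha hb) ?_
  rw [← hσ.smul_self (lt_min ha hb)]
  exact hσ.mono _ _ _ _ (smul_one_nonneg (lt_min ha hb).le) (smul_one_nonneg (lt_min ha hb).le)
    ((smul_one_le_smul_one (min_le_left _ _)).trans haA)
    ((smul_one_le_smul_one (min_le_right _ _)).trans hbB)

/-- Reduction of a mean of strictly positive operators to a mean with the identity. -/
theorem exists_conj_one (hσ : IsOperatorMean σ) {X B : H →L[ℂ] H}
    (hX : IsStrictlyPositive X) (hB : IsStrictlyPositive B) :
    ∃ R C : H →L[ℂ] H, IsStrictlyPositive R ∧ IsStrictlyPositive C ∧ X = R * R ∧ B = R * C * R ∧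
      ∀ t : ℝ, 0 ≤ t → σ X (t • B) = R * σ 1 (t • C) * R := by
  have hXX := CFC.sqrt_mul_sqrt_self X hX.nonneg
  set R := CFC.sqrt X with hR
  have hRu : IsUnit R := by
    have : IsUnit (R * R) := hXX ▸ hX.isUnit
    exact ((Commute.refl R).isUnit_mul_iff.1 this).1
  have hRp : IsStrictlyPositive R := hRu.isStrictlyPositive (CFC.sqrt_nonneg X)
  have hRi := hRp.ringInverse
  have hC : IsStrictlyPositive (Ring.inverse R * B * Ring.inverse R) :=
    hB.conjugate_of_isUnit_of_isSelfAdjoint _ _ hRi.isUnit hRi.isSelfAdjoint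
  have hBC : B = R * (Ring.inverse R * B * Ring.inverse R) * R := by
    simp only [mul_assoc, Ring.inverse_mul_cancel _ hRu, mul_one,
      Ring.mul_inverse_cancel_left _ _ hRu]
  refine ⟨R, _, hRp, hC, hXX.symm, hBC, fun t ht => ?_⟩
  rw [hσ.conj_eq zero_le_one (smul_nonneg ht hC.nonneg) hRp, mul_one, hXX, mul_smul_comm,
    smul_mul_assoc, ← hBC]

section Representing

variable {f : ℝ → ℝ}

theorem representing_concaveOn [Nontrivial H] (hσ : IsOperatorMean σ)
    (hf : ∀ t, 0 < t → σ 1 (t • 1) = f t • (1 : H →L[ℂ] H)) (hH : Module.finrank ℂ H ≠ 1) :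
    ConcaveOn ℝ (Set.Ioi 0) f := by
  refine concaveOn_of_two_valued_monotone hH (fun P Q a b c d hP hQ ha hb hc hd h => ?_)
    fun l t hl ht => hσ.representing_mul_le hf hl ht
  rw [← hσ.one_two_valued hf hP ha hb, ← hσ.one_two_valued hf hQ hc hd]
  exact hσ.mono _ _ _ _ zero_le_one (hP.two_valued_strictlyPositive ha hb).nonneg le_rfl h

/-- The adjoint inherits monotonicity on two-valued operators: inverting both before and after
applying `f` reverses the order twice. -/
theorem representing_adjoint_concaveOn [Nontrivial H] (hσ : IsOperatorMean σ)
    (hf : ∀ t, 0 < t → σ 1 (t • 1) = f t • (1 : H →L[ℂ] H)) (hH : Module.finrank ℂ H ≠ 1) :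
    ConcaveOn ℝ (Set.Ioi 0) fun s => (f s⁻¹)⁻¹ := by
  refine concaveOn_of_two_valued_monotone hH (fun P Q a b c d hP hQ ha hb hc hd h => ?_)
    fun l t hl ht => ?_
  · have pos : ∀ {t : ℝ}, 0 < t → 0 < f t⁻¹ := fun ht => hσ.representing_pos hf (inv_pos.2 ht)
    rw [← hP.inverse_two_valued (pos ha) (pos hb), ← hQ.inverse_two_valued (pos hc) (pos hd)]
    refine CStarAlgebra.ringInverse_le_ringInverse ?_
      (hQ.two_valued_strictlyPositive (pos hc) (pos hd))
    have h' := CStarAlgebra.ringInverse_le_ringInverse h (hP.two_valued_strictlyPositive ha hb)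
    rw [hP.inverse_two_valued ha hb, hQ.inverse_two_valued hc hd] at h'
    have hc' := inv_pos.2 hc
    have hd' := inv_pos.2 hd
    rw [← hσ.one_two_valued hf hP (inv_pos.2 ha) (inv_pos.2 hb),
      ← hσ.one_two_valued hf hQ hc' hd']
    exact hσ.mono _ _ _ _ zero_le_one (hQ.two_valued_strictlyPositive hc' hd').nonneg le_rfl h'
  · have hl0 : 0 < l := by linarith
    have h1 := hσ.representing_mul_le hf hl (inv_pos.2 (mul_pos hl0 ht))
    have h2 : l * (l * t)⁻¹ = t⁻¹ := by field_simp
    rw [h2] at h1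
    have p1 := hσ.representing_pos hf (inv_pos.2 ht)
    have p2 := hσ.representing_pos hf (inv_pos.2 (mul_pos hl0 ht))
    rw [← div_eq_mul_inv, le_div_iff₀ p1, inv_mul_le_iff₀ p2]
    linarith

/-- On a spectral piece where `C` lies in `[s, t]` with `t - s ≤ δ / α`, replacing `t` by `s` in the
tangent line costs at most `δ`, and `δ` is arbitrary. -/
theorem one_le_affine [Nontrivial H] (hσ : IsOperatorMean σ)
    (hf : ∀ t, 0 < t → σ 1 (t • 1) = f t • (1 : H →L[ℂ] H)) {α : ℝ} (hα : 0 < α)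
    (hfα : ∀ t, 0 < t → f t ≤ 1 + α * (t - 1)) {C : H →L[ℂ] H} (hC : IsStrictlyPositive C) :
    σ 1 C ≤ (1 - α) • 1 + α • C := by
  obtain ⟨a, b, ha, hab, haC, hCb⟩ := hC.exists_smul_one_bounds
  rw [← sub_nonneg]
  refine nonneg_of_forall_pos_add_smul_one fun δ hδ => ?_
  refine nonneg_of_forall_compression hC.isSelfAdjoint hab (div_pos hδ hα) haC hCb
    (fun E hE hEC => ?_) fun E s t hE hEC has hst htb hts hs ht => ?_
  · exact ((((Commute.one_right E).smul_right _).add_right (hEC.smul_right _)).sub_right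
      (hσ.conj_projection zero_le_one hC.nonneg hE (Commute.one_right E) hEC).2).add_right
      ((Commute.one_right E).smul_right _)
  · have ht0 : 0 < t := ha.trans_le (has.trans hst)
    have hT := hσ.compression_le hf hC.nonneg hE hEC ht0 ht
    have hsc : f t ≤ (1 - α) + α * s + δ := by
      have := hfα t ht0
      have := mul_le_mul_of_nonneg_left hts hα.le
      rw [mul_div_cancel₀ _ hα.ne'] at this
      linarith
    have h1 : E * ((1 - α) • 1 + α • C - σ 1 C + δ • 1) * E =
        ((1 - α) + δ) • E + α • (E * C * E) - E * σ 1 C * E := by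
      simp only [mul_add, mul_sub, add_mul, sub_mul, mul_smul_comm,
        smul_mul_assoc, mul_one, hE.isIdempotentElem.eq]
      module
    rw [h1, sub_nonneg]
    calc E * σ 1 C * E ≤ f t • E := hT
      _ ≤ ((1 - α) + α * s + δ) • E := smul_le_smul_of_nonneg_right hsc hE.nonneg
      _ = ((1 - α) + δ) • E + α • (s • E) := by module
      _ ≤ _ := by gcongr

theorem inverse_one_le_affine [Nontrivial H] (hσ : IsOperatorMean σ)
    (hf : ∀ t, 0 < t → σ 1 (t • 1) = f t • (1 : H →L[ℂ] H)) {α : ℝ} (hα : 0 < α)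
    (hfα : ∀ s, 0 < s → (f s⁻¹)⁻¹ ≤ 1 + α * (s - 1)) {C : H →L[ℂ] H} (hC : IsStrictlyPositive C) :
    Ring.inverse (σ 1 C) ≤ (1 - α) • 1 + α • Ring.inverse C := by
  obtain ⟨a, b, ha, hab, haC, hCb⟩ := hC.exists_smul_one_bounds
  have hTp := hσ.strictlyPositive isStrictlyPositive_one hC
  have hcommT : ∀ E : H →L[ℂ] H, IsStarProjection E → Commute E C → Commute E (σ 1 C) :=
    fun E hE hEC => (hσ.conj_projection zero_le_one hC.nonneg hE (Commute.one_right E) hEC).2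
  rw [← sub_nonneg]
  refine nonneg_of_forall_pos_add_smul_one fun δ hδ => ?_
  -- Above `a` one has `1/s - 1/t ≤ (t - s) / a ^ 2`, so this width keeps `α (1/s - 1/t)` below `δ`.
  refine nonneg_of_forall_compression hC.isSelfAdjoint hab
    (δ := δ * a ^ 2 / α) (by positivity) haC hCb
    (fun E hE hEC => ?_) fun E s t hE hEC has hst htb hts hs ht => ?_
  · exact ((((Commute.one_right E).smul_right _).add_right (hEC.ringInverse.smul_right _)).sub_right
      (hcommT E hE hEC).ringInverse).add_right ((Commute.one_right E).smul_right _)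
  · have hs0 : 0 < s := ha.trans_le has
    have ht0 : 0 < t := hs0.trans_le hst
    have hT := hTp.inverse_compression_le hE (hcommT E hE hEC) (hσ.representing_pos hf hs0)
      (hσ.le_compression hf hC.nonneg hE hEC hs0 hs)
    have hCi := hC.le_inverse_compression hE hEC ht0 ht
    have hsc : (f s)⁻¹ ≤ (1 - α) + α * t⁻¹ + δ := by
      have h1 := hfα s⁻¹ (inv_pos.2 hs0)
      rw [inv_inv] at h1
      have h2 : α * (s⁻¹ - t⁻¹) ≤ δ := by
        rw [le_div_iff₀ hα] at hts
        have h3 : a ^ 2 ≤ s * t := by nlinarith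
        have h4 : s⁻¹ - t⁻¹ = (t - s) / (s * t) := by field_simp
        rw [h4, ← mul_div_assoc, div_le_iff₀ (by positivity)]
        nlinarith
      linarith
    have h1 : E * ((1 - α) • 1 + α • Ring.inverse C - Ring.inverse (σ 1 C) + δ • 1) * E =
        ((1 - α) + δ) • E + α • (E * Ring.inverse C * E) - E * Ring.inverse (σ 1 C) * E := by
      simp only [mul_add, mul_sub, add_mul, sub_mul, mul_smul_comm,
        smul_mul_assoc, mul_one, hE.isIdempotentElem.eq]
      module
    rw [h1, sub_nonneg]
    calc E * Ring.inverse (σ 1 C) * E ≤ (f s)⁻¹ • E := hT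
      _ ≤ ((1 - α) + α * t⁻¹ + δ) • E := smul_le_smul_of_nonneg_right hsc hE.nonneg
      _ = ((1 - α) + δ) • E + α • (t⁻¹ • E) := by module
      _ ≤ _ := by gcongr

/-- Split `l = r * r`. Shrinking a point of `[a, b]` by one factor `r` costs `f` a definite
fraction, uniformly; the other factor absorbs the width of the spectral pieces, since `t - s ≤ a
(1/r - 1)` gives `r t ≤ s` and hence `l t ≤ r s`. -/
theorem exists_one_smul_le [Nontrivial H] (hσ : IsOperatorMean σ)
    (hf : ∀ t, 0 < t → σ 1 (t • 1) = f t • (1 : H →L[ℂ] H)) (hconc : ConcaveOn ℝ (Set.Ioi 0) f)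
    (hstrict : ∀ s t, 0 < s → s < t → f s < f t) {l : ℝ} (hl0 : 0 < l) (hl1 : l < 1)
    {C : H →L[ℂ] H} (hC : IsStrictlyPositive C) :
    ∃ μ : ℝ, 0 < μ ∧ μ < 1 ∧ σ 1 (l • C) ≤ μ • σ 1 C := by
  obtain ⟨a, b, ha, hab, haC, hCb⟩ := hC.exists_smul_one_bounds
  have hb : 0 < b := ha.trans_le hab
  set r := √l with hr
  have hr0 : 0 < r := Real.sqrt_pos.2 hl0
  have hr1 : r < 1 := by rw [hr, Real.sqrt_lt' one_pos]; simpa using hl1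
  have hrr : r * r = l := Real.mul_self_sqrt hl0.le
  -- The slope over `[b, b + 1]`, positive by strictness; by concavity every slope over an interval
  -- ending at or before `b` is at least this large.
  set κ := f (b + 1) - f b with hκ
  have hκ0 : 0 < κ := sub_pos.2 (hstrict b (b + 1) hb (by linarith))
  have hfb := hσ.representing_pos hf hb
  have hgap : ∀ s, a ≤ s → s ≤ b → f (r * s) ≤ (1 - κ * ((1 - r) * a) / f b) * f s := by
    intro s has hsb
    have hs0 : 0 < s := ha.trans_le has
    have hrs : r * s < s := by nlinarith
    have hslope : κ ≤ (f s - f (r * s)) / (s - r * s) := by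
      have h2 : (f (b + 1) - f b) / (b + 1 - b) = κ := by rw [hκ]; simp
      rcases hsb.eq_or_lt with rfl | hsb'
      · rw [← h2]
        exact hconc.slope_anti_adjacent (mul_pos hr0 hs0) (Set.mem_Ioi.2 (by linarith)) hrs
          (by linarith)
      · rw [← h2]
        exact (hconc.slope_anti_adjacent hs0 (Set.mem_Ioi.2 (by linarith)) hsb'
          (by linarith)).trans
          (hconc.slope_anti_adjacent (mul_pos hr0 hs0) hb hrs hsb')
    rw [le_div_iff₀ (by linarith)] at hslope
    have hfs : f s ≤ f b := hσ.representing_mono hf hs0 hsb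
    have h3 : κ * ((1 - r) * a) / f b * f s ≤ κ * ((1 - r) * a) := by
      rw [div_mul_eq_mul_div, div_le_iff₀ hfb]
      have : 0 ≤ κ * ((1 - r) * a) := by
        have : 0 < 1 - r := by linarith
        positivity
      gcongr
    have h4 : κ * ((1 - r) * a) ≤ κ * (s - r * s) := by
      have : (1 - r) * a ≤ (1 - r) * s := mul_le_mul_of_nonneg_left has (by linarith)
      nlinarith
    linarith
  set μ := 1 - κ * ((1 - r) * a) / f b with hμ
  have hμ1 : μ < 1 := by
    have : 0 < 1 - r := by linarith
    have : 0 < κ * ((1 - r) * a) / f b := by positivity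
    linarith
  have hμ0 : 0 < μ := by
    have h1 := hgap b hab le_rfl
    have h2 := hσ.representing_pos hf (mul_pos hr0 hb)
    by_contra hcon
    have := mul_nonpos_of_nonpos_of_nonneg (not_lt.1 hcon) hfb.le
    linarith
  refine ⟨μ, hμ0, hμ1, ?_⟩
  have hlC : 0 ≤ l • C := smul_nonneg hl0.le hC.nonneg
  rw [← sub_nonneg]
  refine nonneg_of_forall_compression hC.isSelfAdjoint hab
    (δ := a * (r⁻¹ - 1)) (mul_pos ha (sub_pos.2 ((one_lt_inv₀ hr0).2 hr1))) haC hCb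
    (fun E hE hEC => ?_) fun E s t hE hEC has hst htb hts hs ht => ?_
  · exact ((hσ.conj_projection zero_le_one hC.nonneg hE (Commute.one_right E) hEC).2.smul_right
      μ).sub_right (hσ.conj_projection zero_le_one hlC hE (Commute.one_right E)
        (hEC.smul_right l)).2
  · have hs0 : 0 < s := ha.trans_le has
    have ht0 : 0 < t := hs0.trans_le hst
    have h1 : E * (l • C) * E ≤ (l * t) • E := by
      rw [mul_smul_comm, smul_mul_assoc, mul_smul]
      exact smul_le_smul_of_nonneg_left ht hl0.le
    have hup := hσ.compression_le hf hlC hE (hEC.smul_right l) (mul_pos hl0 ht0) h1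
    have hlow := hσ.le_compression hf hC.nonneg hE hEC hs0 hs
    have hlt : l * t ≤ r * s := by
      have h2 : r * t ≤ s := by
        have h5 : t ≤ s * r⁻¹ := by
          have : a * (r⁻¹ - 1) ≤ s * (r⁻¹ - 1) :=
            mul_le_mul_of_nonneg_right has (sub_pos.2 ((one_lt_inv₀ hr0).2 hr1)).le
          linarith
        rwa [← div_eq_mul_inv, le_div_iff₀ hr0, mul_comm] at h5
      rw [← hrr, mul_assoc]
      gcongr
    have hsc : f (l * t) ≤ μ * f s :=
      (hσ.representing_mono hf (mul_pos hl0 ht0) hlt).trans (hgap s has (hst.trans htb))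
    rw [mul_sub E, sub_mul (E * _), sub_nonneg, mul_smul_comm, smul_mul_assoc]
    calc E * σ 1 (l • C) * E ≤ f (l * t) • E := hup
      _ ≤ (μ * f s) • E := smul_le_smul_of_nonneg_right hsc hE.nonneg
      _ = μ • (f s • E) := mul_smul _ _ _
      _ ≤ μ • (E * σ 1 C * E) := smul_le_smul_of_nonneg_left hlow hμ0.le

end Representing

end IsOperatorMean

/-! ### Monotone limits in the strong operator topology. -/

section StrongOperatorTopology

variable {H : Type*} [NormedAddCommGroup H] [InnerProductSpace ℂ H] [CompleteSpace H]

omit [CompleteSpace H] in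
theorem TendstoSOT.le_of_forall_le {A : ℕ → (H →L[ℂ] H)} {L X : H →L[ℂ] H} (h : TendstoSOT A X)
    (hL : ∀ k, L ≤ A k) : L ≤ X := by
  rw [ContinuousLinearMap.le_def, ContinuousLinearMap.isPositive_iff_complex]
  intro x
  have hclosed : IsClosed {z : ℂ | (z.re : ℂ) = z ∧ 0 ≤ z.re} :=
    (isClosed_eq (Complex.continuous_ofReal.comp Complex.continuous_re) continuous_id).inter
      (isClosed_le continuous_const Complex.continuous_re)
  have hlim : Tendsto (fun k => inner ℂ ((A k - L) x) x) atTop (𝓝 (inner ℂ ((X - L) x) x)) :=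
    ((h x).sub tendsto_const_nhds).inner tendsto_const_nhds
  refine hclosed.mem_of_tendsto hlim (Eventually.of_forall fun k => ?_)
  exact (ContinuousLinearMap.isPositive_iff_complex _).1 ((ContinuousLinearMap.le_def _ _).1 (hL k)) x

omit [CompleteSpace H] in
theorem TendstoSOT.unique {A : ℕ → (H →L[ℂ] H)} {X Y : H →L[ℂ] H} (hX : TendstoSOT A X)
    (hY : TendstoSOT A Y) : X = Y :=
  ContinuousLinearMap.ext fun x => tendsto_nhds_unique (hX x) (hY x)

/-- Conjugating `T ≤ ‖T‖` by `√T` gives `T² ≤ ‖T‖ T`. It upgrades convergence of quadratic forms to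
strong convergence. -/
theorem norm_apply_sq_le_of_nonneg {T : H →L[ℂ] H} (hT : 0 ≤ T) (x : H) :
    ‖T x‖ ^ 2 ≤ ‖T‖ * T.reApplyInnerSelf x := by
  have hTs : IsSelfAdjoint T := .of_nonneg hT
  have hS := CFC.sqrt_mul_sqrt_self T hT
  set S := CFC.sqrt T with hSdef
  have hSs : IsSelfAdjoint S := .of_nonneg (CFC.sqrt_nonneg T)
  have h1 := hSs.conjugate_le_conjugate hTs.le_algebraMap_norm_self
  have h2 : S * T * S = T * T := by rw [← hS]; simp only [mul_assoc]
  rw [h2, Algebra.algebraMap_eq_smul_one, mul_smul_comm, smul_mul_assoc, mul_one, hS] at h1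
  have h3 := ((ContinuousLinearMap.le_def _ _).1 h1).re_inner_nonneg_left x
  have h4 : inner ℂ ((T * T) x) x = inner ℂ (T x) (T x) :=
    hTs.isSymmetric (T x) x
  rw [sub_apply, inner_sub_left, h4, map_sub, inner_self_eq_norm_sq, smul_apply,
    inner_smul_left_eq_smul, sub_nonneg] at h3
  simpa [ContinuousLinearMap.reApplyInnerSelf] using h3

/-- Vigier's theorem: a decreasing sequence of selfadjoint operators that is bounded below converges
in the strong operator topology. -/
theorem exists_tendstoSOT_of_antitone {A : ℕ → (H →L[ℂ] H)} {L : H →L[ℂ] H} (hA : Antitone A)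
    (hL : ∀ k, L ≤ A k) : ∃ X, TendstoSOT A X := by
  have hq : ∀ {S T : H →L[ℂ] H}, S ≤ T → ∀ x, S.reApplyInnerSelf x ≤ T.reApplyInnerSelf x :=
    fun {S T} hST x => by
    have := ((ContinuousLinearMap.le_def _ _).1 hST).re_inner_nonneg_left x
    rw [sub_apply, inner_sub_left, map_sub, sub_nonneg] at this
    exact this
  have hcauchy : ∀ x, CauchySeq fun k => A k x := fun x => by
    have ha : Antitone fun k => (A k).reApplyInnerSelf x := fun k l hkl => hq (hA hkl) x
    have hbdd : BddBelow (Set.range fun k => (A k).reApplyInnerSelf x) :=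
      ⟨L.reApplyInnerSelf x, by rintro _ ⟨k, rfl⟩; exact hq (hL k) x⟩
    have hac := (tendsto_atTop_ciInf ha hbdd).cauchySeq
    rw [Metric.cauchySeq_iff'] at hac ⊢
    intro ε hε
    set c := ‖A 0 - L‖ + 1 with hc
    have hc0 : 0 < c := by positivity
    obtain ⟨N, hN⟩ := hac (ε ^ 2 / c) (by positivity)
    refine ⟨N, fun k hk => ?_⟩
    have h1 := hN k hk
    have hpos : 0 ≤ A N - A k := sub_nonneg.2 (hA hk)
    have h2 := norm_apply_sq_le_of_nonneg hpos x
    have h3 : (A N - A k).reApplyInnerSelf x =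
        (A N).reApplyInnerSelf x - (A k).reApplyInnerSelf x := by
      simp [ContinuousLinearMap.reApplyInnerSelf, inner_sub_left]
    have h4 : ‖A N - A k‖ ≤ c := by
      have : ‖A N - A k‖ ≤ ‖A 0 - L‖ :=
        CStarAlgebra.norm_le_norm_of_nonneg_of_le hpos (sub_le_sub (hA (Nat.zero_le N)) (hL k))
      linarith
    have h5 : 0 ≤ (A N).reApplyInnerSelf x - (A k).reApplyInnerSelf x :=
      sub_nonneg.2 (hq (hA hk) x)
    rw [Real.dist_eq, abs_sub_comm, abs_of_nonneg h5, lt_div_iff₀ hc0] at h1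
    rw [h3] at h2
    rw [dist_comm, dist_eq_norm, ← sub_apply]
    have h6 := mul_le_mul_of_nonneg_right h4 h5
    exact lt_of_pow_lt_pow_left₀ 2 hε.le (by linarith)
  choose F hF using fun x => cauchySeq_tendsto_of_complete (hcauchy x)
  exact ⟨continuousLinearMapOfTendsto A (tendsto_pi_nhds.2 hF), fun x => hF x⟩

theorem decreasesTo_add_inv_smul_one (A : H →L[ℂ] H) :
    DecreasesTo (fun k : ℕ => A + (1 / ((k : ℝ) + 1)) • (1 : H →L[ℂ] H)) A := by
  refine ⟨fun k l hkl => ?_, fun x => ?_⟩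
  · refine add_le_add le_rfl (smul_one_le_smul_one ?_)
    gcongr
  · have h : Tendsto (fun k : ℕ => A x + (1 / ((k : ℝ) + 1)) • x) atTop (𝓝 (A x + (0 : ℝ) • x)) :=
      tendsto_const_nhds.add (tendsto_one_div_add_atTop_nhds_zero_nat.smul tendsto_const_nhds)
    rw [zero_smul, add_zero] at h
    exact h

end StrongOperatorTopology

/-! ### Consequences of not being left trivial. -/

namespace IsOperatorMean

variable {H : Type*} [NormedAddCommGroup H] [InnerProductSpace ℂ H] [CompleteSpace H]
  {σ : (H →L[ℂ] H) → (H →L[ℂ] H) → (H →L[ℂ] H)}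

/-- Squeezing `C` between scalars gives `σ 1 C = 1`, and congruence gives `σ X B = X` for strictly
positive arguments. Adding `1 / (k + 1)` and downward continuity reach all positive operators, as
`IsLeftTrivial` requires. -/
theorem isLeftTrivial_of_representing_eq_one [Nontrivial H] (hσ : IsOperatorMean σ) {f : ℝ → ℝ}
    (hf : ∀ t, 0 < t → σ 1 (t • 1) = f t • (1 : H →L[ℂ] H)) (h1 : ∀ t, 0 < t → f t = 1) :
    IsLeftTrivial σ := by
  have hone : ∀ C : H →L[ℂ] H, IsStrictlyPositive C → σ 1 C = 1 := fun C hC => by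
    obtain ⟨a, b, ha, hab, haC, hCb⟩ := hC.exists_smul_one_bounds
    have key : ∀ t : ℝ, 0 < t → σ 1 (t • 1) = (1 : H →L[ℂ] H) := fun t ht => by
      rw [hf t ht, h1 t ht, one_smul]
    exact le_antisymm
      ((hσ.mono _ _ _ _ zero_le_one hC.nonneg le_rfl hCb).trans_eq (key b (ha.trans_le hab)))
      ((key a ha).ge.trans (hσ.mono _ _ _ _ zero_le_one (smul_one_nonneg ha.le) le_rfl haC))
  have hsp : ∀ X B : H →L[ℂ] H, IsStrictlyPositive X → IsStrictlyPositive B → σ X B = X :=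
    fun X B hX hB => by
    obtain ⟨R, C, -, hC, hXR, -, hR⟩ := hσ.exists_conj_one hX hB
    have := hR 1 zero_le_one
    rw [one_smul, one_smul, hone C hC, mul_one, ← hXR] at this
    exact this
  intro A B hA hB
  have hA' := decreasesTo_add_inv_smul_one A
  have hB' := decreasesTo_add_inv_smul_one B
  have hpos : ∀ T : H →L[ℂ] H, 0 ≤ T → ∀ k : ℕ,
      IsStrictlyPositive (T + (1 / ((k : ℝ) + 1)) • (1 : H →L[ℂ] H)) := fun T hT k =>
    .nonneg_add hT (isStrictlyPositive_one.smul (by positivity))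
  have h := (hσ.downward_continuous _ _ A B (fun k => (hpos A hA k).nonneg)
    (fun k => (hpos B hB k).nonneg) hA hB hA' hB').2
  have h' : (fun k : ℕ => σ (A + (1 / ((k : ℝ) + 1)) • 1) (B + (1 / ((k : ℝ) + 1)) • 1)) =
      fun k : ℕ => A + (1 / ((k : ℝ) + 1)) • (1 : H →L[ℂ] H) :=
    funext fun k => hsp _ _ (hpos A hA k) (hpos B hB k)
  rw [h'] at h
  exact h.unique hA'.2

section NotLeftTrivial

theorem exists_representing_strict [Nontrivial H] (hσ : IsOperatorMean σ) (hσl : ¬ IsLeftTrivial σ)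
    (hH : Module.finrank ℂ H ≠ 1) :
    ∃ f : ℝ → ℝ, (∀ t, 0 < t → σ 1 (t • 1) = f t • (1 : H →L[ℂ] H)) ∧
      ∀ s t, 0 < s → s < t → f s < f t := by
  obtain ⟨f, hf⟩ := hσ.exists_representing
  refine ⟨f, hf, fun s t hs hst => ?_⟩
  refine (hσ.representing_concaveOn hf hH).lt_of_adjoint_concaveOn
    (hσ.representing_adjoint_concaveOn hf hH) (fun s t hs hst => hσ.representing_mono hf hs hst)
    (fun t ht => hσ.representing_pos hf ht) ?_ hs hst
  by_contra! hc
  exact hσl (hσ.isLeftTrivial_of_representing_eq_one hf fun t ht =>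
    (hc t ht).trans (hσ.representing_one hf))

theorem exists_le_affine [Nontrivial H] (hσ : IsOperatorMean σ) (hσl : ¬ IsLeftTrivial σ)
    (hH : Module.finrank ℂ H ≠ 1) :
    ∃ α : ℝ, 0 < α ∧ ∀ X B : H →L[ℂ] H, IsStrictlyPositive X → IsStrictlyPositive B →
      σ X B ≤ (1 - α) • X + α • B := by
  obtain ⟨f, hf, hstrict⟩ := hσ.exists_representing_strict hσl hH
  have h1 := hσ.representing_one hf
  obtain ⟨α, hα, hfα⟩ := (hσ.representing_concaveOn hf hH).exists_pos_slope h1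
    (by have := hstrict 1 2 one_pos one_lt_two; rwa [h1] at this)
  refine ⟨α, hα, fun X B hX hB => ?_⟩
  obtain ⟨R, C, hR, hC, rfl, rfl, hRC⟩ := hσ.exists_conj_one hX hB
  have h := hRC 1 zero_le_one
  rw [one_smul, one_smul] at h
  rw [h]
  refine (hR.isSelfAdjoint.conjugate_le_conjugate (hσ.one_le_affine hf hα hfα hC)).trans_eq ?_
  simp only [mul_add, add_mul, mul_smul_comm, smul_mul_assoc, mul_one]

theorem exists_inverse_le_affine [Nontrivial H] (hσ : IsOperatorMean σ) (hσl : ¬ IsLeftTrivial σ)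
    (hH : Module.finrank ℂ H ≠ 1) :
    ∃ α : ℝ, 0 < α ∧ ∀ X B : H →L[ℂ] H, IsStrictlyPositive X → IsStrictlyPositive B →
      Ring.inverse (σ X B) ≤ (1 - α) • Ring.inverse X + α • Ring.inverse B := by
  obtain ⟨f, hf, hstrict⟩ := hσ.exists_representing_strict hσl hH
  have h1 := hσ.representing_one hf
  obtain ⟨α, hα, hfα⟩ := (hσ.representing_adjoint_concaveOn hf hH).exists_pos_slope
    (by rw [inv_one, h1, inv_one]) (by
      have := hstrict 2⁻¹ 1 (by norm_num) (by norm_num)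
      rw [h1] at this
      exact (one_lt_inv₀ (hσ.representing_pos hf (by norm_num))).2 this)
  refine ⟨α, hα, fun X B hX hB => ?_⟩
  obtain ⟨R, C, hR, hC, rfl, rfl, hRC⟩ := hσ.exists_conj_one hX hB
  have h := hRC 1 zero_le_one
  rw [one_smul, one_smul] at h
  rw [h, hR.isUnit.ringInverse_conj, hR.isUnit.ringInverse_conj,
    Ring.inverse_mul (Or.inl hR.isUnit)]
  refine (hR.ringInverse.isSelfAdjoint.conjugate_le_conjugate
    (hσ.inverse_one_le_affine hf hα hfα hC)).trans_eq ?_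
  simp only [mul_add, add_mul, mul_smul_comm, smul_mul_assoc, mul_one]

/-- By homogeneity `σ (l X) B = l σ X (B / l)`, and shrinking the second argument gains a factor
below 1. -/
theorem exists_smul_left_le [Nontrivial H] (hσ : IsOperatorMean σ) (hσl : ¬ IsLeftTrivial σ)
    (hH : Module.finrank ℂ H ≠ 1) {X B : H →L[ℂ] H} (hX : IsStrictlyPositive X)
    (hB : IsStrictlyPositive B) {l : ℝ} (hl : 1 < l) :
    ∃ μ : ℝ, μ < l ∧ σ (l • X) B ≤ μ • σ X B := by
  obtain ⟨f, hf, hstrict⟩ := hσ.exists_representing_strict hσl hH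
  have hl0 : 0 < l := by linarith
  obtain ⟨R, C, hR, hC, hXR, hBC, hRC⟩ := hσ.exists_conj_one hX hB
  obtain ⟨μ, hμ0, hμ1, hμ⟩ := hσ.exists_one_smul_le hf (hσ.representing_concaveOn hf hH) hstrict
    (inv_pos.2 hl0) (inv_lt_one_of_one_lt₀ hl) hC
  refine ⟨l * μ, by nlinarith, ?_⟩
  have h1 := hRC 1 zero_le_one
  rw [one_smul, one_smul] at h1
  have h2 : σ (l • X) B = l • σ X (l⁻¹ • B) := by
    rw [← hσ.smul_eq hX.nonneg (smul_nonneg (inv_pos.2 hl0).le hB.nonneg) hl0, smul_smul,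
      mul_inv_cancel₀ hl0.ne', one_smul]
  rw [h2, hRC _ (inv_pos.2 hl0).le, h1, mul_smul]
  refine smul_le_smul_of_nonneg_left ?_ hl0.le
  have := hR.isSelfAdjoint.conjugate_le_conjugate hμ
  rwa [mul_smul_comm, smul_mul_assoc] at this

end NotLeftTrivial

end IsOperatorMean

/-! ### Existence, uniqueness and bounds for the deformed mean. -/

section DeformedMean

variable {H : Type*} [NormedAddCommGroup H] [InnerProductSpace ℂ H] [CompleteSpace H] {n : ℕ}

/-- Common scalar bounds for finitely many strictly positive operators. -/
theorem exists_common_smul_one_bounds [Nontrivial H] [NeZero n] {B : Fin n → (H →L[ℂ] H)}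
    (hB : ∀ j, IsStrictlyPositive (B j)) :
    ∃ a b : ℝ, 0 < a ∧ a ≤ b ∧ (∀ j, a • (1 : H →L[ℂ] H) ≤ B j) ∧
      ∀ j, B j ≤ b • (1 : H →L[ℂ] H) := by
  choose a b ha hab haB hBb using fun j => (hB j).exists_smul_one_bounds
  obtain ⟨i, hi⟩ := Finite.exists_min a
  obtain ⟨k, hk⟩ := Finite.exists_max b
  exact ⟨a i, b k, ha i, (hab i).trans (hk i),
    fun j => (smul_one_le_smul_one (hi j)).trans (haB j),
    fun j => (hBb j).trans (smul_one_le_smul_one (hk j))⟩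

theorem IsStrictlyPositive.weighted_sum [Nontrivial H] [NeZero n] {ω : Fin n → ℝ}
    (hω : ∀ j, 0 ≤ ω j) (hω1 : ∑ j, ω j = 1) {B : Fin n → (H →L[ℂ] H)}
    (hB : ∀ j, IsStrictlyPositive (B j)) : IsStrictlyPositive (∑ j, ω j • B j) := by
  obtain ⟨a, b, ha, -, haB, hBb⟩ := exists_common_smul_one_bounds hB
  exact .of_smul_one_le ha (arithmeticMean_mem_bounds hω hω1 haB hBb).1

namespace IsMultiOperatorMean

variable {𝔐 : (Fin n → (H →L[ℂ] H)) → (H →L[ℂ] H)}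

theorem smul_eq (h𝔐 : IsMultiOperatorMean 𝔐) {B : Fin n → (H →L[ℂ] H)}
    (hB : ∀ j, IsStrictlyPositive (B j)) {t : ℝ} (ht : 0 < t) :
    𝔐 (fun j => t • B j) = t • 𝔐 B := by
  have hs : IsStrictlyPositive (√t • (1 : H →L[ℂ] H)) :=
    isStrictlyPositive_one.smul (Real.sqrt_pos.2 ht)
  have h := h𝔐.congruence B _ hB hs.isUnit
  rw [hs.isSelfAdjoint.star_eq] at h
  simpa only [smul_one_conj, Real.mul_self_sqrt ht.le] using h.symm

theorem smul_one_eq (h𝔐 : IsMultiOperatorMean 𝔐) {t : ℝ} (ht : 0 < t) :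
    𝔐 (fun _ => t • 1) = t • (1 : H →L[ℂ] H) := by
  rw [h𝔐.smul_eq (fun _ => isStrictlyPositive_one) ht, h𝔐.normalized]

end IsMultiOperatorMean

variable {𝔐 : (Fin n → (H →L[ℂ] H)) → (H →L[ℂ] H)}
  {σ : (H →L[ℂ] H) → (H →L[ℂ] H) → (H →L[ℂ] H)} {B : Fin n → (H →L[ℂ] H)}

theorem exists_isDeformedMeanSolution [Nontrivial H] [NeZero n] (h𝔐 : IsMultiOperatorMean 𝔐)
    (hσ : IsOperatorMean σ) (hB : ∀ j, IsStrictlyPositive (B j)) :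
    ∃ X, IsDeformedMeanSolution 𝔐 σ B X := by
  obtain ⟨a, b, ha, hab, haB, hBb⟩ := exists_common_smul_one_bounds hB
  have hb : 0 < b := ha.trans_le hab
  set Φ : (H →L[ℂ] H) → (H →L[ℂ] H) := fun X => 𝔐 fun j => σ X (B j) with hΦ
  have hsp : ∀ {X : H →L[ℂ] H}, a • 1 ≤ X → IsStrictlyPositive X := fun h => .of_smul_one_le ha h
  have hσsp : ∀ {X : H →L[ℂ] H}, a • 1 ≤ X → ∀ j, IsStrictlyPositive (σ X (B j)) :=
    fun h j => hσ.strictlyPositive (hsp h) (hB j)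
  have hmono : ∀ {X Y : H →L[ℂ] H}, a • 1 ≤ X → X ≤ Y → Φ X ≤ Φ Y := fun {X Y} hX hXY =>
    h𝔐.mono _ _ (hσsp hX) (hσsp (hX.trans hXY)) fun j =>
      hσ.mono _ _ _ _ (hsp hX).nonneg (hB j).nonneg hXY le_rfl
  have hlow : ∀ {X : H →L[ℂ] H}, a • 1 ≤ X → a • 1 ≤ Φ X := fun {X} hX => by
    rw [← h𝔐.smul_one_eq ha]
    refine h𝔐.mono _ _ (fun _ => isStrictlyPositive_one.smul ha) (hσsp hX) fun j => ?_
    rw [← hσ.smul_self ha]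
    exact hσ.mono _ _ _ _ (smul_one_nonneg ha.le) (smul_one_nonneg ha.le) hX (haB j)
  have hab1 : a • (1 : H →L[ℂ] H) ≤ b • 1 := smul_one_le_smul_one hab
  have hup : Φ (b • 1) ≤ b • 1 := by
    nth_rw 2 [← h𝔐.smul_one_eq hb]
    refine h𝔐.mono _ _ (hσsp hab1) (fun _ => isStrictlyPositive_one.smul hb) fun j => ?_
    nth_rw 2 [← hσ.smul_self hb]
    exact hσ.mono _ _ _ _ (smul_one_nonneg hb.le) (hB j).nonneg le_rfl (hBb j)
  -- The iteration starts at the top of the interval so that it decreases: `σ` is assumed continuous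
  -- only along decreasing sequences.
  set Y : ℕ → (H →L[ℂ] H) := fun k => Φ^[k] (b • 1) with hY
  have hYs : ∀ k, Y (k + 1) = Φ (Y k) := fun k => Function.iterate_succ_apply' Φ k _
  have hYa : ∀ k, a • 1 ≤ Y k := fun k => by
    induction k with
    | zero => exact hab1
    | succ k ih => rw [hYs]; exact hlow ih
  have hYanti : Antitone Y := antitone_nat_of_succ_le fun k => by
    induction k with
    | zero => exact hup
    | succ k ih =>
      rw [hYs (k + 1)]
      exact (hmono (hYa (k + 1)) ih).trans_eq (hYs k).symm
  obtain ⟨X, hX⟩ := exists_tendstoSOT_of_antitone hYanti hYa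
  have hXa : a • 1 ≤ X := hX.le_of_forall_le hYa
  refine ⟨X, hsp hXa, ?_⟩
  have hdec : ∀ j, DecreasesTo (fun k => σ (Y k) (B j)) (σ X (B j)) := fun j =>
    hσ.downward_continuous Y (fun _ => B j) X (B j) (fun k => (hsp (hYa k)).nonneg)
      (fun _ => (hB j).nonneg) (hsp hXa).nonneg (hB j).nonneg ⟨hYanti, hX⟩
      ⟨antitone_const, fun _ => tendsto_const_nhds⟩
  have hlim := h𝔐.monotone_continuous (fun k j => σ (Y k) (B j)) (fun j => σ X (B j))
    (fun k => hσsp (hYa k)) (hσsp hXa) (Or.inr hdec)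
  have hshift : TendstoSOT (fun k => Y (k + 1)) X := fun x => (hX x).comp (tendsto_add_atTop_nat 1)
  simp only [hYs] at hshift
  exact hshift.unique hlim

/-- Let `l` be the least number `≥ 1` with `X ≤ l Y`. If `l > 1`, applying the fixed-point map to `X
≤ l Y` gives `X ≤ ν Y`, where `ν < l` is the maximum of 1 and the finitely many factors from
`exists_smul_left_le`. -/
theorem IsDeformedMeanSolution.le [Nontrivial H] [NeZero n] (h𝔐 : IsMultiOperatorMean 𝔐)
    (hσ : IsOperatorMean σ) (hσl : ¬ IsLeftTrivial σ) (hH : Module.finrank ℂ H ≠ 1)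
    (hB : ∀ j, IsStrictlyPositive (B j)) {X Y : H →L[ℂ] H} (hX : IsDeformedMeanSolution 𝔐 σ B X)
    (hY : IsDeformedMeanSolution 𝔐 σ B Y) : X ≤ Y := by
  obtain ⟨hXp, hXe⟩ := hX
  obtain ⟨hYp, hYe⟩ := hY
  set S : Set ℝ := {l | 1 ≤ l ∧ X ≤ l • Y} with hS
  have hclosed' : IsClosed {l : ℝ | X ≤ l • Y} :=
    isClosed_le continuous_const (continuous_id.smul continuous_const)
  have hclosed : IsClosed S := isClosed_Ici.inter hclosed'
  have hbdd : BddBelow S := ⟨1, fun l hl => hl.1⟩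
  have hne : S.Nonempty := by
    obtain ⟨-, b, -, -, -, hXb⟩ := hXp.exists_smul_one_bounds
    obtain ⟨a, -, ha, -, haY, -⟩ := hYp.exists_smul_one_bounds
    refine ⟨max 1 (b / a), le_max_left _ _, hXb.trans ?_⟩
    calc b • (1 : H →L[ℂ] H) ≤ (max 1 (b / a) * a) • 1 :=
          smul_one_le_smul_one ((div_le_iff₀ ha).1 (le_max_right _ _))
      _ = max 1 (b / a) • a • 1 := mul_smul _ _ _
      _ ≤ _ := smul_le_smul_of_nonneg_left haY (zero_le_one.trans (le_max_left _ _))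
  obtain ⟨hl1, hlX⟩ := hclosed.csInf_mem hne hbdd
  set l := sInf S with hl
  rcases hl1.eq_or_lt with h1 | h1
  · rwa [← h1, one_smul] at hlX
  exfalso
  have hlY : IsStrictlyPositive (l • Y) := hYp.smul (by linarith)
  choose μ hμl hμ using fun j => hσ.exists_smul_left_le hσl hH hYp (hB j) h1
  obtain ⟨i, hi⟩ := Finite.exists_max μ
  have hν : 1 ≤ max 1 (μ i) := le_max_left _ _
  have hνX : X ≤ max 1 (μ i) • Y := by
    have hν0 : 0 < max 1 (μ i) := by linarith
    have hσY := fun j => hσ.strictlyPositive hYp (hB j)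
    have hΦ : max 1 (μ i) • Y = 𝔐 fun j => max 1 (μ i) • σ Y (B j) :=
      (congrArg _ hYe).trans (h𝔐.smul_eq hσY hν0).symm
    refine hXe.le.trans (le_trans ?_ hΦ.ge)
    refine h𝔐.mono _ _ (fun j => hσ.strictlyPositive hXp (hB j)) (fun j => (hσY j).smul hν0)
      fun j => ?_
    calc σ X (B j) ≤ σ (l • Y) (B j) := hσ.mono _ _ _ _ hXp.nonneg (hB j).nonneg hlX le_rfl
      _ ≤ μ j • σ Y (B j) := hμ j
      _ ≤ _ := smul_le_smul_of_nonneg_right ((hi j).trans (le_max_right _ _)) (hσY j).nonneg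
  have := csInf_le hbdd (show max 1 (μ i) ∈ S from ⟨hν, hνX⟩)
  rw [← hl] at this
  exact absurd this (not_le.2 (max_lt h1 (hμl i)))

theorem existsUnique_isDeformedMeanSolution [Nontrivial H] [NeZero n]
    (h𝔐 : IsMultiOperatorMean 𝔐) (hσ : IsOperatorMean σ) (hσl : ¬ IsLeftTrivial σ)
    (hH : Module.finrank ℂ H ≠ 1) (hB : ∀ j, IsStrictlyPositive (B j)) :
    ∃! X, IsDeformedMeanSolution 𝔐 σ B X := by
  obtain ⟨X, hX⟩ := exists_isDeformedMeanSolution h𝔐 hσ hB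
  exact ⟨X, hX, fun Y hY => le_antisymm (hY.le h𝔐 hσ hσl hH hB hX) (hX.le h𝔐 hσ hσl hH hB hY)⟩

/-- The hypothesis rearranges to `0 ≤ α (S - X)`; the sign of `1 - α` plays no role. -/
theorem le_of_le_affine {X S : H →L[ℂ] H} {α : ℝ} (hα : 0 < α) (h : X ≤ (1 - α) • X + α • S) :
    X ≤ S := by
  have h1 : 0 ≤ α • (S - X) := by
    rw [← sub_nonneg] at h
    refine h.trans_eq ?_
    module
  have h2 := smul_nonneg (inv_pos.2 hα).le h1
  rwa [smul_smul, inv_mul_cancel₀ hα.ne', one_smul, sub_nonneg] at h2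

omit [CompleteSpace H] in
theorem weighted_sum_affine {ω : Fin n → ℝ} (hω1 : ∑ j, ω j = 1) (α : ℝ) (X : H →L[ℂ] H)
    (B : Fin n → (H →L[ℂ] H)) :
    ∑ j, ω j • ((1 - α) • X + α • B j) = (1 - α) • X + α • ∑ j, ω j • B j := by
  simp only [smul_add, Finset.sum_add_distrib, ← Finset.sum_smul, hω1, one_smul,
    Finset.smul_sum, smul_comm α]

theorem IsDeformedMeanSolution.le_arithmeticMean [Nontrivial H] (hσ : IsOperatorMean σ)
    (hσl : ¬ IsLeftTrivial σ) (hH : Module.finrank ℂ H ≠ 1) {ω : Fin n → ℝ}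
    (hω : ∀ j, 0 ≤ ω j) (hω1 : ∑ j, ω j = 1)
    (hMA : ∀ B : Fin n → (H →L[ℂ] H), (∀ j, IsStrictlyPositive (B j)) → 𝔐 B ≤ arithmeticMean ω B)
    (hB : ∀ j, IsStrictlyPositive (B j)) {X : H →L[ℂ] H} (hX : IsDeformedMeanSolution 𝔐 σ B X) :
    X ≤ arithmeticMean ω B := by
  obtain ⟨hXp, hXe⟩ := hX
  obtain ⟨α, hα, h⟩ := hσ.exists_le_affine hσl hH
  refine le_of_le_affine hα ?_
  calc X ≤ arithmeticMean ω fun j => σ X (B j) := by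
        nth_rw 1 [hXe]
        exact hMA _ fun j => hσ.strictlyPositive hXp (hB j)
    _ ≤ ∑ j, ω j • ((1 - α) • X + α • B j) :=
        Finset.sum_le_sum fun j _ => smul_le_smul_of_nonneg_left (h X (B j) hXp (hB j)) (hω j)
    _ = _ := weighted_sum_affine hω1 α X B

/-- The arithmetic argument for inverses: inverting the harmonic bound gives `X⁻¹ ≤ ∑ ω_j (X σ
B_j)⁻¹`, the affine bound for inverses removes `σ`, and a second inversion concludes. -/
theorem IsDeformedMeanSolution.harmonicMean_le [Nontrivial H] [NeZero n] (hσ : IsOperatorMean σ)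
    (hσl : ¬ IsLeftTrivial σ) (hH : Module.finrank ℂ H ≠ 1) {ω : Fin n → ℝ}
    (hω : ∀ j, 0 ≤ ω j) (hω1 : ∑ j, ω j = 1)
    (hHM : ∀ B : Fin n → (H →L[ℂ] H), (∀ j, IsStrictlyPositive (B j)) → harmonicMean ω B ≤ 𝔐 B)
    (hB : ∀ j, IsStrictlyPositive (B j)) {X : H →L[ℂ] H} (hX : IsDeformedMeanSolution 𝔐 σ B X) :
    harmonicMean ω B ≤ X := by
  obtain ⟨hXp, hXe⟩ := hX
  obtain ⟨α, hα, h⟩ := hσ.exists_inverse_le_affine hσl hH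
  have hσp := fun j => hσ.strictlyPositive hXp (hB j)
  have hsum := IsStrictlyPositive.weighted_sum hω hω1 fun j => (hσp j).ringInverse
  have h1 : Ring.inverse X ≤ ∑ j, ω j • Ring.inverse (σ X (B j)) := by
    have h2 := hHM _ hσp
    rw [← hXe] at h2
    have h3 := CStarAlgebra.ringInverse_le_ringInverse h2 hsum.ringInverse
    rwa [harmonicMean, Ring.inverse_inverse hsum.isUnit] at h3
  have h4 : Ring.inverse X ≤ ∑ j, ω j • Ring.inverse (B j) := by
    refine le_of_le_affine hα (h1.trans ?_)
    rw [← weighted_sum_affine hω1 α (Ring.inverse X)]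
    exact Finset.sum_le_sum fun j _ =>
      smul_le_smul_of_nonneg_left (h X (B j) hXp (hB j)) (hω j)
  have h5 := CStarAlgebra.ringInverse_le_ringInverse h4 hXp.ringInverse
  rwa [Ring.inverse_inverse hXp.isUnit] at h5

end DeformedMean

/-! ### Powers, logarithms and exponentials of operators. -/

section Powers

variable {H : Type*} [NormedAddCommGroup H] [InnerProductSpace ℂ H] [CompleteSpace H]

theorem IsStrictlyPositive.rpow_const {A : H →L[ℂ] H} (hA : IsStrictlyPositive A) (p : ℝ) :
    IsStrictlyPositive (A ^ p) :=
  (hA.isUnit.cfcRpow p hA.nonneg).isStrictlyPositive CFC.rpow_nonneg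

theorem IsStrictlyPositive.ringInverse_rpow {A : H →L[ℂ] H} (hA : IsStrictlyPositive A) (p : ℝ) :
    Ring.inverse (A ^ p) = A ^ (-p) := by
  rw [← mul_one (Ring.inverse _), ← CFC.rpow_mul_rpow_neg p hA,
    Ring.inverse_mul_cancel_left _ _ (hA.rpow_const p).isUnit]

theorem norm_rpow_neg {A : H →L[ℂ] H} (hA : IsStrictlyPositive A) {r : ℝ} (hr : 0 < r) :
    ‖A ^ (-r)‖ = ‖Ring.inverse A‖ ^ r := by
  rw [← CFC.norm_rpow _ hr hA.ringInverse.nonneg, CFC.inverse_eq_rpow_neg_one hA,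
    CFC.rpow_rpow A (-1) r (by norm_num) hA, neg_one_mul]

theorem rpow_bounds {A : H →L[ℂ] H} {m M p : ℝ} (hm : 0 < m) (hmA : m • (1 : H →L[ℂ] H) ≤ A)
    (hAM : A ≤ M • (1 : H →L[ℂ] H)) (hp : 0 ≤ p) :
    m ^ p • (1 : H →L[ℂ] H) ≤ A ^ p ∧ A ^ p ≤ M ^ p • (1 : H →L[ℂ] H) := by
  have hA : IsStrictlyPositive A := .of_smul_one_le hm hmA
  have hsa := hA.isSelfAdjoint
  have hcont : ContinuousOn (fun x : ℝ => x ^ p) (spectrum ℝ A) := fun x _ =>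
    (Real.continuousAt_rpow_const _ _ (Or.inr hp)).continuousWithinAt
  rw [CFC.rpow_eq_cfc_real hA.nonneg, ← Algebra.algebraMap_eq_smul_one,
    ← Algebra.algebraMap_eq_smul_one]
  have hl := (smul_one_le_iff_le_spectrum hsa).1 hmA
  exact ⟨algebraMap_le_cfc _ _ _ (fun x hx => Real.rpow_le_rpow hm.le (hl x hx) hp) hcont hsa,
    cfc_le_algebraMap _ _ _ (fun x hx => Real.rpow_le_rpow (hm.le.trans (hl x hx))
      ((le_smul_one_iff_spectrum_le hsa).1 hAM x hx) hp) hcont hsa⟩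

theorem rpow_neg_bounds {A : H →L[ℂ] H} {m M p : ℝ} (hm : 0 < m) (hmA : m • (1 : H →L[ℂ] H) ≤ A)
    (hAM : A ≤ M • (1 : H →L[ℂ] H)) (hp : 0 ≤ p) :
    M ^ (-p) • (1 : H →L[ℂ] H) ≤ A ^ (-p) ∧ A ^ (-p) ≤ m ^ (-p) • (1 : H →L[ℂ] H) := by
  have hA : IsStrictlyPositive A := .of_smul_one_le hm hmA
  have hsa := hA.isSelfAdjoint
  have hl := (smul_one_le_iff_le_spectrum hsa).1 hmA
  have hcont : ContinuousOn (fun x : ℝ => x ^ (-p)) (spectrum ℝ A) := fun x hx =>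
    (Real.continuousAt_rpow_const _ _ (Or.inl (hm.trans_le (hl x hx)).ne')).continuousWithinAt
  rw [CFC.rpow_eq_cfc_real hA.nonneg, ← Algebra.algebraMap_eq_smul_one,
    ← Algebra.algebraMap_eq_smul_one]
  exact ⟨algebraMap_le_cfc _ _ _ (fun x hx => Real.rpow_le_rpow_of_nonpos
      (hm.trans_le (hl x hx)) ((le_smul_one_iff_spectrum_le hsa).1 hAM x hx) (by linarith)) hcont hsa,
    cfc_le_algebraMap _ _ _ (fun x hx => Real.rpow_le_rpow_of_nonpos hm (hl x hx) (by linarith))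
      hcont hsa⟩

theorem log_bounds {A : H →L[ℂ] H} {m M : ℝ} (hm : 0 < m) (hmA : m • (1 : H →L[ℂ] H) ≤ A)
    (hAM : A ≤ M • (1 : H →L[ℂ] H)) :
    Real.log m • (1 : H →L[ℂ] H) ≤ CFC.log A ∧ CFC.log A ≤ Real.log M • (1 : H →L[ℂ] H) := by
  have hA : IsStrictlyPositive A := .of_smul_one_le hm hmA
  have hsa := hA.isSelfAdjoint
  have hl := (smul_one_le_iff_le_spectrum hsa).1 hmA
  have hcont : ContinuousOn Real.log (spectrum ℝ A) := fun x hx =>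
    (Real.continuousAt_log (hm.trans_le (hl x hx)).ne').continuousWithinAt
  rw [CFC.log, ← Algebra.algebraMap_eq_smul_one, ← Algebra.algebraMap_eq_smul_one]
  exact ⟨algebraMap_le_cfc _ _ _ (fun x hx => Real.log_le_log hm (hl x hx)) hcont hsa,
    cfc_le_algebraMap _ _ _ (fun x hx => Real.log_le_log (hm.trans_le (hl x hx))
      ((le_smul_one_iff_spectrum_le hsa).1 hAM x hx)) hcont hsa⟩

theorem exp_smul_eq_rpow {L : H →L[ℂ] H} (hL : IsSelfAdjoint L) (c : ℝ) :
    NormedSpace.exp (c • L) = NormedSpace.exp L ^ c := by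
  have hcL : IsSelfAdjoint (c • L) := (IsSelfAdjoint.all c).smul hL
  rw [← CFC.real_exp_eq_normedSpace_exp hcL, ← CFC.real_exp_eq_normedSpace_exp hL,
    CFC.cfc_rpow (fun x _ => Real.exp_pos x) (by fun_prop) hL]
  have h : c • L = cfc (fun x : ℝ => c * x) L := by
    rw [cfc_const_mul c (fun x => x) L, cfc_id' ℝ L]
  rw [h, ← cfc_comp Real.exp _ L]
  refine cfc_congr fun x _ => ?_
  simp only [Function.comp_apply]
  rw [← Real.exp_mul, mul_comm]

theorem exp_strictlyPositive {L : H →L[ℂ] H} (hL : IsSelfAdjoint L) :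
    IsStrictlyPositive (NormedSpace.exp L) :=
  IsUnit.isStrictlyPositive (by
    rw [← CFC.real_exp_eq_normedSpace_exp hL]
    exact (isUnit_cfc_iff Real.exp L).2 fun x _ => (Real.exp_pos x).ne') hL.exp_nonneg

theorem norm_mono {S T : H →L[ℂ] H} (hS : 0 ≤ S) (h : S ≤ T) : ‖S‖ ≤ ‖T‖ :=
  CStarAlgebra.norm_le_norm_of_nonneg_of_le hS h

end Powers

section RealPowers

/-- Extraction of the final root: used with `r = q / p` for the Kantorovich bounds, and with `r =
1`, `q = p` for the Specht bounds. -/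
theorem rpow_mul_rpow_le_of_le {K x y r q p : ℝ} (hK : 0 < K) (hx : 0 ≤ x) (hy : 0 ≤ y)
    (hq : 0 < q) (hr : r * (1 / q) = 1 / p) (h : x ^ r ≤ K * y) :
    K ^ (-(1 / q)) * x ^ (1 / p) ≤ y ^ (1 / q) := by
  have h1 := Real.rpow_le_rpow (Real.rpow_nonneg hx r) h (one_div_pos.2 hq).le
  rw [← Real.rpow_mul hx, hr, Real.mul_rpow hK.le hy] at h1
  rw [Real.rpow_neg hK.le, inv_mul_le_iff₀ (Real.rpow_pos_of_pos hK _)]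
  exact h1

theorem rpow_le_rpow_mul_of_le {K x y r q p : ℝ} (hK : 0 < K) (hx : 0 ≤ x) (hy : 0 ≤ y)
    (hq : 0 < q) (hr : r * (1 / q) = 1 / p) (h : y ≤ K * x ^ r) :
    y ^ (1 / q) ≤ K ^ (1 / q) * x ^ (1 / p) := by
  have h1 := Real.rpow_le_rpow hy h (one_div_pos.2 hq).le
  rwa [Real.mul_rpow hK.le (Real.rpow_nonneg hx r), ← Real.rpow_mul hx, hr] at h1

end RealPowers

/-! ### Norm inequalities for operators bounded by weighted means of powers. -/

section NormInequalities

variable {H : Type*} [NormedAddCommGroup H] [InnerProductSpace ℂ H] [CompleteSpace H]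
  {n : ℕ} {ω : Fin n → ℝ} {A : Fin n → (H →L[ℂ] H)} {m M : ℝ}

theorem harmonicMean_rpow (hA : ∀ j, IsStrictlyPositive (A j)) (p : ℝ) :
    harmonicMean ω (fun j => A j ^ p) = Ring.inverse (∑ j, ω j • A j ^ (-p)) := by
  simp only [harmonicMean, (hA _).ringInverse_rpow]

/-- The Kantorovich complement is applied to `A j ^ (-p)` with exponent `-q/p`. The left side
becomes `∑ ω_j A_j ^ q`, the right side a power of the harmonic mean of the `A j ^ p`; the spectral
ratio is `(M / m) ^ p`. -/
theorem norm_le_kantorovichConst_mul_norm_rpow [Nontrivial H] [NeZero n]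
    (hω : ∀ j, 0 ≤ ω j) (hω1 : ∑ j, ω j = 1)
    (hm : 0 < m) (hmM : m < M) (hmA : ∀ j, m • (1 : H →L[ℂ] H) ≤ A j)
    (hAM : ∀ j, A j ≤ M • (1 : H →L[ℂ] H)) {p q : ℝ} (hq : 0 < q) (hp : 0 < p)
    {G F : H →L[ℂ] H} (hF0 : 0 ≤ F) (hF : F ≤ arithmeticMean ω fun j => A j ^ q)
    (hG : harmonicMean ω (fun j => A j ^ p) ≤ G) :
    ‖F‖ ≤ kantorovichConst ((M / m) ^ p) (-(q / p)) * ‖G‖ ^ (q / p) := by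
  have hM : 0 < M := hm.trans hmM
  have hA : ∀ j, IsStrictlyPositive (A j) := fun j => .of_smul_one_le hm (hmA j)
  have hr : 0 < q / p := div_pos hq hp
  have hSp := IsStrictlyPositive.weighted_sum hω hω1 fun j => (hA j).rpow_const (-p)
  have hK1 := one_le_kantorovichConst (Real.one_lt_rpow ((one_lt_div hm).2 hmM) hp) hr
  have hratio : m ^ (-p) / M ^ (-p) = (M / m) ^ p := by
    rw [Real.rpow_neg hm.le, Real.rpow_neg hM.le, Real.div_rpow hM.le hm.le]
    field_simp
  have hMP := sum_rpow_neg_le_kantorovichConst_smul hω hω1 (Real.rpow_pos_of_pos hM _)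
    (Real.rpow_lt_rpow_of_neg hm hmM (neg_neg_of_pos hp)) hr
    (fun j => (rpow_neg_bounds hm (hmA j) (hAM j) hp.le).1)
    (fun j => (rpow_neg_bounds hm (hmA j) (hAM j) hp.le).2)
  rw [hratio] at hMP
  have hexp : -p * -(q / p) = q := by field_simp
  simp only [CFC.rpow_rpow _ (-p) _ (neg_ne_zero.2 hp.ne') (hA _), hexp] at hMP
  rw [harmonicMean_rpow hA] at hG
  calc ‖F‖ ≤ ‖kantorovichConst ((M / m) ^ p) (-(q / p)) •
        (∑ j, ω j • A j ^ (-p)) ^ (-(q / p))‖ := norm_mono hF0 (hF.trans hMP)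
    _ = kantorovichConst ((M / m) ^ p) (-(q / p)) *
        ‖Ring.inverse (∑ j, ω j • A j ^ (-p))‖ ^ (q / p) := by
      rw [norm_smul, Real.norm_of_nonneg (zero_le_one.trans hK1), norm_rpow_neg hSp hr]
    _ ≤ _ := by
      have := norm_mono hSp.ringInverse.nonneg hG
      gcongr

theorem sum_rpow_neg_le_kantorovichConst_smul_rpow (hω : ∀ j, 0 ≤ ω j) (hω1 : ∑ j, ω j = 1)
    (hm : 0 < m) (hmM : m < M) (hmA : ∀ j, m • (1 : H →L[ℂ] H) ≤ A j)
    (hAM : ∀ j, A j ≤ M • (1 : H →L[ℂ] H)) {p q : ℝ} (hq : 0 < q) (hp : 0 < p) :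
    ∑ j, ω j • A j ^ (-q) ≤ kantorovichConst ((M / m) ^ p) (-(q / p)) •
      (∑ j, ω j • A j ^ p) ^ (-(q / p)) := by
  have hA : ∀ j, IsStrictlyPositive (A j) := fun j => .of_smul_one_le hm (hmA j)
  have hMP := sum_rpow_neg_le_kantorovichConst_smul hω hω1 (Real.rpow_pos_of_pos hm _)
    (Real.rpow_lt_rpow hm.le hmM hp) (div_pos hq hp)
    (fun j => (rpow_bounds hm (hmA j) (hAM j) hp.le).1)
    (fun j => (rpow_bounds hm (hmA j) (hAM j) hp.le).2)
  have hexp : p * -(q / p) = -q := by field_simp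
  have hAA : ∀ j, (A j ^ p) ^ (-(q / p)) = A j ^ (-q) := fun j => by
    rw [CFC.rpow_rpow _ p _ hp.ne' (hA j), hexp]
  rw [← Real.div_rpow (hm.trans hmM).le hm.le] at hMP
  simpa only [hAA] using hMP

/-- Here the complement is applied to `A j ^ p`, which bounds `∑ ω_j A_j ^ (-q)`; inversion turns it
into a lower bound for the harmonic mean of the `A j ^ q`. -/
theorem norm_rpow_le_kantorovichConst_mul_norm [Nontrivial H] [NeZero n]
    (hω : ∀ j, 0 ≤ ω j) (hω1 : ∑ j, ω j = 1)
    (hm : 0 < m) (hmM : m < M) (hmA : ∀ j, m • (1 : H →L[ℂ] H) ≤ A j)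
    (hAM : ∀ j, A j ≤ M • (1 : H →L[ℂ] H)) {p q : ℝ} (hq : 0 < q) (hp : 0 < p)
    {G F : H →L[ℂ] H} (hG0 : 0 ≤ G) (hG : G ≤ arithmeticMean ω fun j => A j ^ p)
    (hF : harmonicMean ω (fun j => A j ^ q) ≤ F) :
    ‖G‖ ^ (q / p) ≤ kantorovichConst ((M / m) ^ p) (-(q / p)) * ‖F‖ := by
  have hA : ∀ j, IsStrictlyPositive (A j) := fun j => .of_smul_one_le hm (hmA j)
  have hr : 0 < q / p := div_pos hq hp
  have hSp := IsStrictlyPositive.weighted_sum hω hω1 fun j => (hA j).rpow_const p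
  have hSq := IsStrictlyPositive.weighted_sum hω hω1 fun j => (hA j).rpow_const (-q)
  have hK1 := one_le_kantorovichConst (Real.one_lt_rpow ((one_lt_div hm).2 hmM) hp) hr
  have hMP := sum_rpow_neg_le_kantorovichConst_smul_rpow hω hω1 hm hmM hmA hAM hq hp
  set K := kantorovichConst ((M / m) ^ p) (-(q / p)) with hK
  have hK0 : 0 < K := by linarith
  have hinv := CStarAlgebra.ringInverse_le_ringInverse hMP hSq
  rw [Ring.inverse_smul (hSp.rpow_const _).isUnit hK0.ne', hSp.ringInverse_rpow, neg_neg,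
    ← harmonicMean_rpow hA] at hinv
  have h1 := norm_mono (smul_nonneg (inv_pos.2 hK0).le CFC.rpow_nonneg) (hinv.trans hF)
  rw [norm_smul, Real.norm_of_nonneg (inv_pos.2 hK0).le, CFC.norm_rpow _ hr hSp.nonneg,
    inv_mul_le_iff₀ hK0] at h1
  exact (Real.rpow_le_rpow (norm_nonneg _) (norm_mono hG0 hG) hr.le).trans h1

theorem rpow_eq_exp_smul_log {T : H →L[ℂ] H} (hT : IsStrictlyPositive T) (p : ℝ) :
    T ^ p = NormedSpace.exp (p • CFC.log T) := by
  rw [exp_smul_eq_rpow IsSelfAdjoint.log, CFC.exp_log T hT]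

theorem exp_mul_log_sub_log (hm : 0 < m) (hM : 0 < M) (p : ℝ) :
    Real.exp (p * Real.log M - p * Real.log m) = (M / m) ^ p := by
  rw [Real.rpow_def_of_pos (div_pos hM hm), Real.log_div hM.ne' hm.ne']
  ring_nf

/-- The Specht complement is applied to `p log A_j` and to `-p log A_j`. Both lie in intervals of
length `p log (M / m)`, hence the common constant. The first estimate serves the arithmetic bound,
the second, inverted, the harmonic one. -/
theorem sum_rpow_le_spechtRatio_smul (hω : ∀ j, 0 ≤ ω j) (hω1 : ∑ j, ω j = 1)
    (hm : 0 < m) (hmM : m < M) (hmA : ∀ j, m • (1 : H →L[ℂ] H) ≤ A j)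
    (hAM : ∀ j, A j ≤ M • (1 : H →L[ℂ] H)) {p : ℝ} (hp : 0 < p) :
    ∑ j, ω j • A j ^ p ≤
        spechtRatio ((M / m) ^ p) • NormedSpace.exp (∑ j, ω j • CFC.log (A j)) ^ p ∧
      ∑ j, ω j • A j ^ (-p) ≤
        spechtRatio ((M / m) ^ p) • NormedSpace.exp (∑ j, ω j • CFC.log (A j)) ^ (-p) := by
  have hM : 0 < M := hm.trans hmM
  have hA : ∀ j, IsStrictlyPositive (A j) := fun j => .of_smul_one_le hm (hmA j)
  have hlog := Real.log_lt_log hm hmM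
  have hLs : IsSelfAdjoint (∑ j, ω j • CFC.log (A j)) :=
    isSelfAdjoint_sum _ fun j _ => (IsSelfAdjoint.all (ω j)).smul IsSelfAdjoint.log
  have hsum : ∀ c : ℝ, ∑ j, ω j • c • CFC.log (A j) = c • ∑ j, ω j • CFC.log (A j) := fun c => by
    simp only [Finset.smul_sum, smul_comm c]
  have hsc : ∀ c : ℝ, ∀ j, IsSelfAdjoint (c • CFC.log (A j)) := fun c j =>
    (IsSelfAdjoint.all c).smul IsSelfAdjoint.log
  have hb := fun j => log_bounds hm (hmA j) (hAM j)
  constructor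
  · have h := sum_exp_le_spechtRatio_smul hω hω1 (hsc p) (mul_lt_mul_of_pos_left hlog hp)
      (fun j => by rw [mul_smul]; exact smul_le_smul_of_nonneg_left (hb j).1 hp.le)
      (fun j => by rw [mul_smul]; exact smul_le_smul_of_nonneg_left (hb j).2 hp.le)
    rw [exp_mul_log_sub_log hm hM, hsum, exp_smul_eq_rpow hLs] at h
    simpa only [rpow_eq_exp_smul_log (hA _) p] using h
  · have h := sum_exp_le_spechtRatio_smul hω hω1 (hsc (-p))
      (mul_lt_mul_of_neg_left hlog (neg_neg_of_pos hp))
      (fun j => by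
        rw [mul_smul, neg_smul, neg_smul]
        exact neg_le_neg (smul_le_smul_of_nonneg_left (hb j).2 hp.le))
      (fun j => by
        rw [mul_smul, neg_smul, neg_smul]
        exact neg_le_neg (smul_le_smul_of_nonneg_left (hb j).1 hp.le))
    have hratio : -p * Real.log m - -p * Real.log M = p * Real.log M - p * Real.log m := by ring
    rw [hratio, exp_mul_log_sub_log hm hM, hsum, exp_smul_eq_rpow hLs] at h
    simpa only [rpow_eq_exp_smul_log (hA _) (-p)] using h

theorem norm_le_spechtRatio_mul_norm_exp (hω : ∀ j, 0 ≤ ω j) (hω1 : ∑ j, ω j = 1)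
    (hm : 0 < m) (hmM : m < M) (hmA : ∀ j, m • (1 : H →L[ℂ] H) ≤ A j)
    (hAM : ∀ j, A j ≤ M • (1 : H →L[ℂ] H)) {p : ℝ} (hp : 0 < p)
    {G : H →L[ℂ] H} (hG0 : 0 ≤ G) (hG : G ≤ arithmeticMean ω fun j => A j ^ p) :
    ‖G‖ ≤ spechtRatio ((M / m) ^ p) * ‖NormedSpace.exp (∑ j, ω j • CFC.log (A j))‖ ^ p := by
  have hLs : IsSelfAdjoint (∑ j, ω j • CFC.log (A j)) :=
    isSelfAdjoint_sum _ fun j _ => (IsSelfAdjoint.all (ω j)).smul IsSelfAdjoint.log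
  have hS1 := one_le_spechtRatio (Real.one_lt_rpow ((one_lt_div hm).2 hmM) hp)
  have h := norm_mono hG0 (hG.trans (sum_rpow_le_spechtRatio_smul hω hω1 hm hmM hmA hAM hp).1)
  rwa [norm_smul, Real.norm_of_nonneg (zero_le_one.trans hS1),
    CFC.norm_rpow _ hp hLs.exp_nonneg] at h

theorem norm_exp_le_spechtRatio_mul_norm [Nontrivial H] [NeZero n]
    (hω : ∀ j, 0 ≤ ω j) (hω1 : ∑ j, ω j = 1)
    (hm : 0 < m) (hmM : m < M) (hmA : ∀ j, m • (1 : H →L[ℂ] H) ≤ A j)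
    (hAM : ∀ j, A j ≤ M • (1 : H →L[ℂ] H)) {p : ℝ} (hp : 0 < p)
    {G : H →L[ℂ] H} (hG : harmonicMean ω (fun j => A j ^ p) ≤ G) :
    ‖NormedSpace.exp (∑ j, ω j • CFC.log (A j))‖ ^ p ≤ spechtRatio ((M / m) ^ p) * ‖G‖ := by
  have hA : ∀ j, IsStrictlyPositive (A j) := fun j => .of_smul_one_le hm (hmA j)
  have hLs : IsSelfAdjoint (∑ j, ω j • CFC.log (A j)) :=
    isSelfAdjoint_sum _ fun j _ => (IsSelfAdjoint.all (ω j)).smul IsSelfAdjoint.log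
  have hE := exp_strictlyPositive hLs
  have hS1 := one_le_spechtRatio (Real.one_lt_rpow ((one_lt_div hm).2 hmM) hp)
  have hS0 : 0 < spechtRatio ((M / m) ^ p) := by linarith
  have hSp := IsStrictlyPositive.weighted_sum hω hω1 fun j => (hA j).rpow_const (-p)
  have hinv := CStarAlgebra.ringInverse_le_ringInverse
    (sum_rpow_le_spechtRatio_smul hω hω1 hm hmM hmA hAM hp).2 hSp
  rw [Ring.inverse_smul (hE.rpow_const _).isUnit hS0.ne', hE.ringInverse_rpow, neg_neg,
    ← harmonicMean_rpow hA] at hinv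
  have h1 := norm_mono (smul_nonneg (inv_pos.2 hS0).le CFC.rpow_nonneg) (hinv.trans hG)
  rwa [norm_smul, Real.norm_of_nonneg (inv_pos.2 hS0).le, CFC.norm_rpow _ hp hE.nonneg,
    inv_mul_le_iff₀ hS0] at h1

end NormInequalities

theorem theorem4p2 {H : Type*} [NormedAddCommGroup H] [InnerProductSpace ℂ H] [CompleteSpace H]
    (hH : Module.finrank ℂ H ≠ 1) {n : ℕ}
    (𝔐 : (Fin n → (H →L[ℂ] H)) → (H →L[ℂ] H)) (h𝔐 : IsMultiOperatorMean 𝔐)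
    (σ : (H →L[ℂ] H) → (H →L[ℂ] H) → (H →L[ℂ] H)) (hσ : IsOperatorMean σ)
    (hσl : ¬ IsLeftTrivial σ)
    (ω : Fin n → ℝ) (hω : ∀ j, 0 ≤ ω j) (hω1 : ∑ j, ω j = 1)
    (hHM : ∀ B : Fin n → (H →L[ℂ] H), (∀ j, IsStrictlyPositive (B j)) →
      harmonicMean ω B ≤ 𝔐 B)
    (hMA : ∀ B : Fin n → (H →L[ℂ] H), (∀ j, IsStrictlyPositive (B j)) →
      𝔐 B ≤ arithmeticMean ω B)
    (m M : ℝ) (hm : 0 < m) (hmM : m < M)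
    (A : Fin n → (H →L[ℂ] H)) (hA : ∀ j, IsStrictlyPositive (A j))
    (hmA : ∀ j, m • (1 : H →L[ℂ] H) ≤ A j) (hAM : ∀ j, A j ≤ M • (1 : H →L[ℂ] H)) :
    -- the deformed mean is well defined on all tuples of positive invertible operators
    (∀ B : Fin n → (H →L[ℂ] H), (∀ j, IsStrictlyPositive (B j)) →
      ∃! X, IsDeformedMeanSolution 𝔐 σ B X) ∧
    (∀ p q : ℝ, 0 < q → q < p →
      kantorovichConst ((M / m) ^ p) (-(q / p)) ^ (-(1 / q)) *
          ‖deformedMean 𝔐 σ (fun j => A j ^ p)‖ ^ (1 / p)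
        ≤ ‖deformedMean 𝔐 σ (fun j => A j ^ q)‖ ^ (1 / q) ∧
      ‖deformedMean 𝔐 σ (fun j => A j ^ q)‖ ^ (1 / q)
        ≤ kantorovichConst ((M / m) ^ p) (-(q / p)) ^ (1 / q) *
          ‖deformedMean 𝔐 σ (fun j => A j ^ p)‖ ^ (1 / p)) ∧
    (∀ p : ℝ, 0 < p →
      spechtRatio ((M / m) ^ p) ^ (-(1 / p)) *
          ‖deformedMean 𝔐 σ (fun j => A j ^ p)‖ ^ (1 / p)
        ≤ ‖NormedSpace.exp (∑ j, ω j • CFC.log (A j))‖ ∧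
      ‖NormedSpace.exp (∑ j, ω j • CFC.log (A j))‖
        ≤ spechtRatio ((M / m) ^ p) ^ (1 / p) *
          ‖deformedMean 𝔐 σ (fun j => A j ^ p)‖ ^ (1 / p)) := by
  -- On the zero space every map is left trivial.
  have hnt : Nontrivial H := not_subsingleton_iff_nontrivial.1 fun h =>
    hσl fun _ _ _ _ => Subsingleton.elim _ _
  have hn : NeZero n := ⟨by rintro rfl; simp at hω1⟩
  have hex : ∀ B : Fin n → (H →L[ℂ] H), (∀ j, IsStrictlyPositive (B j)) →
      ∃! X, IsDeformedMeanSolution 𝔐 σ B X := fun B hB =>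
    existsUnique_isDeformedMeanSolution h𝔐 hσ hσl hH hB
  have hsol : ∀ p : ℝ, IsDeformedMeanSolution 𝔐 σ (fun j => A j ^ p)
      (deformedMean 𝔐 σ fun j => A j ^ p) := fun p => by
    have h := (hex _ fun j => (hA j).rpow_const p).exists
    rw [deformedMean, dif_pos h]
    exact h.choose_spec
  have hpos : ∀ p : ℝ, 0 ≤ deformedMean 𝔐 σ fun j => A j ^ p := fun p => (hsol p).1.nonneg
  have hupper := fun p : ℝ => (hsol p).le_arithmeticMean hσ hσl hH hω hω1 hMA
    fun j => (hA j).rpow_const p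
  have hlower := fun p : ℝ => (hsol p).harmonicMean_le hσ hσl hH hω hω1 hHM
    fun j => (hA j).rpow_const p
  have hratio : 1 < M / m := (one_lt_div hm).2 hmM
  refine ⟨hex, fun p q hq hqp => ?_, fun p hp => ?_⟩
  · have hp : 0 < p := hq.trans hqp
    have hK : 0 < kantorovichConst ((M / m) ^ p) (-(q / p)) := zero_lt_one.trans_le
      (one_le_kantorovichConst (Real.one_lt_rpow hratio hp) (div_pos hq hp))
    have hr : q / p * (1 / q) = 1 / p := by field_simp
    exact ⟨rpow_mul_rpow_le_of_le hK (norm_nonneg _) (norm_nonneg _) hq hr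
        (norm_rpow_le_kantorovichConst_mul_norm hω hω1 hm hmM hmA hAM hq hp (hpos p) (hupper p)
          (hlower q)),
      rpow_le_rpow_mul_of_le hK (norm_nonneg _) (norm_nonneg _) hq hr
        (norm_le_kantorovichConst_mul_norm_rpow hω hω1 hm hmM hmA hAM hq hp (hpos q) (hupper q)
          (hlower p))⟩
  · have hS : 0 < spechtRatio ((M / m) ^ p) :=
      zero_lt_one.trans_le (one_le_spechtRatio (Real.one_lt_rpow hratio hp))
    set e := ‖NormedSpace.exp (∑ j, ω j • CFC.log (A j))‖ with he
    have he0 : 0 ≤ e := norm_nonneg _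
    have hpe : (e ^ p) ^ (1 / p) = e := by
      rw [← Real.rpow_mul he0, mul_one_div_cancel hp.ne', Real.rpow_one]
    have h1 := norm_le_spechtRatio_mul_norm_exp hω hω1 hm hmM hmA hAM hp (hpos p) (hupper p)
    have h2 := norm_exp_le_spechtRatio_mul_norm hω hω1 hm hmM hmA hAM hp (hlower p)
    rw [← he] at h1 h2
    have h3 := rpow_mul_rpow_le_of_le (r := 1) (q := p) (p := p) hS
      (norm_nonneg (deformedMean 𝔐 σ fun j => A j ^ p)) (Real.rpow_nonneg he0 p) hp (one_mul _)
      (by rwa [Real.rpow_one])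
    have h4 := rpow_le_rpow_mul_of_le (r := 1) (q := p) (p := p) hS
      (norm_nonneg (deformedMean 𝔐 σ fun j => A j ^ p)) (Real.rpow_nonneg he0 p) hp (one_mul _)
      (by rwa [Real.rpow_one])
    rw [hpe] at h3 h4
    exact ⟨h3, h4⟩
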